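/- Consider the synchronous randomized CONGEST model on a connected undirected graph $G=(V,E)$ with $n=|V|\ge 2$ nodes. The nodes have distinct identity numbers from $\{0,\dots,n^c-1\}$, and the edges have nonnegative integer weights at most $n^c$, for a constant $c$. Initially each node knows $n$, its own identity number, the identity numbers of its neighbours and the weights of its incident edges; it also has private fair random coins. In each round it may send one word, i.e. a block of $O(\log n)$ bits, over each of its edges (in each direction). Local computation is free. Let $d(u,v)$ be the weighted shortest-path distance, let $h(u,v)$ be the least number of edges on a simple $u$–$v$ path of weight $d(u,v)$, and let $S=\max_{u,v\in V}h(u,v)$ be the shortest-path diameter (which is not known to the nodes). There is a distributed algorithm in this model after which each node $u$ has halted with a sketch $L(u)$, together with a symmetric rule that computes an estimate $d'(u,v)=d'(v,u)$ from $L(u)$ and $L(v)$ (and $n$) alone, such that the following hold simultaneously with high probability, i.e. for each prescribed constant $a$ the algorithm can be chosen so that they hold with probability at least $1-n^{-a}$: 1. all nodes have halted after $O(S\log^4 n)$ rounds, and $O(S|E|\log^4 n)$ messages have been sent in total; 2. each sketch consists of $O(\log^4 n)$ words; 3. $d(u,v)\le d'(u,v)\le O(\log n)\cdot d(u,v)$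 for all $u,v\in V$; 4. the average stretch $\frac1{\binom n2}\sum_{\{u,v\}\subseteq V,\,u\ne v}\frac{d'(u,v)}{d(u,v)}$ is $O(1)$, where a pair with $d(u,v)=0$ (hence $d'(u,v)=0$) is counted with the value $1$. The constants in 3 and 4 are absolute, those in 1 and 2 depend only on $a$, and the constant in the word length depends only on $c$. -/

import Mathlib

/-! Weighted networks, the synchronous CONGEST model with private coins, and distance sketches. -/

namespace DistSketch

/-- A weighted, undirected, connected communication network on the node set `V`, whose nodes
carry distinct identity numbers. Only the values of `weight` on edges matter. -/
structure Network (V : Type) where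
  graph : SimpleGraph V
  connected : graph.Connected
  weight : Sym2 V → ℕ
  ident : V → ℕ
  ident_injective : Function.Injective ident

namespace Network

variable {V : Type}

/-- The total weight of a walk. -/
def walkWeight (N : Network V) {u v : V} (p : N.graph.Walk u v) : ℕ :=
  (p.edges.map N.weight).sum

/-- The weighted shortest-path distance `d(u, v)`. -/
noncomputable def dist (N : Network V) (u v : V) : ℕ :=
  sInf {m : ℕ | ∃ p : N.graph.Walk u v, N.walkWeight p = m}

/-- `h(u, v)`: the least number of edges on a simple path of total weight `d(u, v)`. -/
noncomputable def hops (N : Network V) (u v : V) : ℕ :=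
  sInf {k : ℕ | ∃ p : N.graph.Walk u v, p.IsPath ∧ N.walkWeight p = N.dist u v ∧ p.length = k}

/-- The shortest-path diameter `S = max_{u,v} h(u, v)`. -/
noncomputable def spDiam [Fintype V] (N : Network V) : ℕ :=
  Finset.univ.sup fun u : V => Finset.univ.sup fun v : V => N.hops u v

/-- The number `|E|` of edges. -/
noncomputable def numEdges (N : Network V) : ℕ := N.graph.edgeSet.ncard

/-- Identity numbers and edge weights are polynomially bounded in the number of nodes,
with exponent `c`. -/
def PolyBounded [Fintype V] (N : Network V) (c : ℕ) : Prop :=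
  (∀ v, N.ident v < Fintype.card V ^ c) ∧
    ∀ e ∈ N.graph.edgeSet, N.weight e ≤ Fintype.card V ^ c

open Classical in
/-- The neighbour of `v` whose identity number is `x`, if there is one. -/
noncomputable def neighbor (N : Network V) (v : V) (x : ℕ) : Option V :=
  if h : ∃ u, N.graph.Adj v u ∧ N.ident u = x then some h.choose else none

end Network

/-- A word of `B * ⌈log₂ n⌉` bits. -/
abbrev Word (B n : ℕ) : Type := BitVec (B * Nat.clog 2 n)

/-- What a node knows initially about the network (besides the number of nodes): its own identity
number, the identity numbers of its neighbours, and the weights of its edges.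
`nbrWeight x` is the weight of the edge to the neighbour with identity number `x`, and `none` if
no neighbour has this identity number. -/
structure LocalView where
  ident : ℕ
  nbrWeight : ℕ → Option ℕ

/-- The initial knowledge of the node `v`. -/
noncomputable def Network.view {V : Type} (N : Network V) (v : V) : LocalView where
  ident := N.ident v
  nbrWeight x := (N.neighbor v x).map fun u => N.weight s(v, u)

/-- The program that every node runs. Messages are elements of `M`; a node has `coins` private
fair random bits. In each round a node may send, to each neighbour (addressed by its identity
number), at most one message determined by its state, and then updates its state according to the
messages that it gets from its neighbours. A node has halted once its output is defined. -/
structure NodeProgram (M : Type) where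
  State : Type
  coins : ℕ
  init : LocalView → (Fin coins → Bool) → State
  send : State → ℕ → Option M
  receive : State → (ℕ → Option M) → State
  output : State → Option (List M)

namespace NodeProgram

variable {M V : Type}

/-- The outcomes of all private coins of all nodes. -/
abbrev Coins (A : NodeProgram M) (V : Type) : Type := V → Fin A.coins → Bool

open Classical in
/-- The message that `u` sends to `v` when the nodes are in the states `σ`: only along edges, and
none once `u` has halted. -/
noncomputable def message (A : NodeProgram M) (N : Network V) (σ : V → A.State) (u v : V) :
    Option M :=
  if N.graph.Adj u v ∧ A.output (σ u) = none then A.send (σ u) (N.ident v) else none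

/-- One synchronous round. A node that has halted keeps its state. -/
noncomputable def round (A : NodeProgram M) (N : Network V) (σ : V → A.State) : V → A.State :=
  fun v =>
    match A.output (σ v) with
    | some _ => σ v
    | none => A.receive (σ v) fun x => (N.neighbor v x).bind fun u => A.message N σ u v

/-- The states of all nodes after `t` rounds, when the coins fall as in `ω`. -/
noncomputable def run (A : NodeProgram M) (N : Network V) (ω : A.Coins V) : ℕ → V → A.State
  | 0 => fun v => A.init (N.view v) (ω v)
  | t + 1 => A.round N (A.run N ω t)

/-- The number of messages sent in the first `T` rounds. -/
noncomputable def messageCount (A : NodeProgram M) (N : Network V) (ω : A.Coins V) (T : ℕ) : ℕ :=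
  ∑ t ∈ Finset.range T, {p : V × V | A.message N (A.run N ω t) p.1 p.2 ≠ none}.ncard

/-- After `T` rounds every node has halted, the node `v` with the output `L v`. -/
def HaltsWith (A : NodeProgram M) (N : Network V) (ω : A.Coins V) (T : ℕ) (L : V → List M) :
    Prop :=
  ∀ v, A.output (A.run N ω T v) = some (L v)

/-- The probability of an event over independent fair private coins of all nodes. -/
noncomputable def prob (A : NodeProgram M) (V : Type) (E : Set (A.Coins V)) : ℝ :=
  (E.ncard : ℝ) / (Nat.card (A.Coins V) : ℝ)

end NodeProgram

/-- A distributed sketching algorithm (for networks of one size): a node program whose outputs,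
lists of words, serve as sketches, and a symmetric rule that computes a distance estimate from two
sketches alone. -/
structure SketchAlgorithm (M : Type) extends NodeProgram M where
  estimate : List M → List M → ℕ
  estimate_comm : ∀ x y, estimate x y = estimate y x

/-- The ratio `d'(u, v) / d(u, v)`; a pair at distance `0` counts as `1` (a finite stretch bound
forces `d'(u, v) = 0` there). -/
noncomputable def pairStretch {V : Type} (N : Network V) (d' : V → V → ℕ) (u v : V) : ℝ :=
  if N.dist u v = 0 then 1 else (d' u v : ℝ) / (N.dist u v : ℝ)

/-- The average stretch of symmetric estimates `d'`. The sum runs over the `n (n - 1)` ordered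
pairs of distinct nodes, in which each of the `n.choose 2` unordered pairs occurs twice. -/
noncomputable def averageStretch {V : Type} [Fintype V] [DecidableEq V] (N : Network V)
    (d' : V → V → ℕ) : ℝ :=
  (∑ p ∈ (Finset.univ : Finset V).offDiag, pairStretch N d' p.1 p.2) /
    ((Fintype.card V : ℝ) * ((Fintype.card V : ℝ) - 1))

end DistSketch

/-!
The sketches come from one hierarchy of random levels `V = A₀ ⊇ A₁ ⊇ ⋯ ⊇ A_top`, in which a node
survives each step with probability `1 / 2`. For every level, a node stores its `R = O(log n)`
nearest nodes of the level with their distances, where ties are broken by identity numbers; the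
estimate for two nodes is the least length of a detour over a node that both store for the same
level.

*Stretch.* Let `m` be a large multiple of `log n`, let the `i`-th neighbourhood of `u` consist of
the `m * 2 ^ i` nodes nearest to `u`, and stop the hierarchy just before the neighbourhoods exhaust
the network. With high probability, the `j`-th level meets every `j`-th neighbourhood and has less
than `R` nodes in every `(j + 1)`-st one (`exists_prob_wellSpread`). Then a node of the `j`-th level
that `v` does not store is at least as far away from `v` as some node of the next level
(`WellSpread.levelTable_eq_or`). So the search of Thorup and Zwick for a common entry, which swaps
the two nodes and climbs by one level in each step, loses only `2 * d(u, v)` per level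
(`WellSpread.detour_le_of_entry`), and it may start at any level whose neighbourhood of `u` does not
contain `v`, since the nearest node of this level is not farther away than `v`. Hence the stretch of
a pair is at most `3` plus twice the number of neighbourhoods of `u` that contain `v`
(`WellSpread.detour_le_card`). This is `O(log n)`, and as the sizes of the neighbourhoods grow
geometrically up to `n`, its average is `O(1)` (`averageStretch_le`).

*Computation.* The tables are computed by Bellman–Ford updates on truncated tables. If `w` is
among the `R` nearest nodes of a level for `v`, then so it is for all nodes on a shortest path from
`v` to `w`; hence the truncation does no harm (`Params.table_eq_dist`), and the tables
are exact and stable as soon as the number of updates exceeds the shortest-path diameter `S`. An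
update takes as many rounds as a node stores words, so `O(log² n)`
(`BroadcastProgram.run_toNodeProgram`).

*Termination.* As `S` is unknown, it is guessed, with doubling guesses `g`. In a phase with the
guess `g`, the least identity number is flooded for `g` super-rounds. Then a node objects if a
neighbour has seen another least number, or if its own tables have just changed, and the objections are
flooded for `2 * g` super-rounds. The nodes that have seen the same number are within distance `g`
of its owner, so they are within distance `2 * g` of each other. If one of them hears of no
objection, none of them has a neighbour that has seen another number, so they are all nodes of the network
(`Params.PhaseStart.not_objects`). Therefore all nodes decide in the same way at the end of a phase;
they halt only if no truncated table has changed anywhere, in which case the tables are exact for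
good, and they do halt once `g` exceeds `S`. Here distances are numbers of edges.
-/

/-! ### Shortest paths in a network -/

namespace DistSketch

namespace Network

variable {V : Type} (N : Network V)

@[simp] lemma walkWeight_nil (u : V) : N.walkWeight (.nil : N.graph.Walk u u) = 0 := rfl

@[simp] lemma walkWeight_cons {u v w : V} (h : N.graph.Adj u v) (p : N.graph.Walk v w) :
    N.walkWeight (.cons h p) = N.weight s(u, v) + N.walkWeight p := rfl

lemma walkWeight_append {u v w : V} (p : N.graph.Walk u v) (q : N.graph.Walk v w) :
    N.walkWeight (p.append q) = N.walkWeight p + N.walkWeight q := by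
  simp [walkWeight]

lemma walkWeight_reverse {u v : V} (p : N.graph.Walk u v) :
    N.walkWeight p.reverse = N.walkWeight p := by
  simp [walkWeight]

lemma dist_le_walkWeight {u v : V} (p : N.graph.Walk u v) : N.dist u v ≤ N.walkWeight p :=
  Nat.sInf_le ⟨p, rfl⟩

lemma exists_walkWeight_eq_dist (u v : V) : ∃ p : N.graph.Walk u v, N.walkWeight p = N.dist u v :=
  Nat.sInf_mem (s := {m : ℕ | ∃ p : N.graph.Walk u v, N.walkWeight p = m})
    ⟨_, (N.connected.preconnected u v).some, rfl⟩

@[simp] lemma dist_self (u : V) : N.dist u u = 0 :=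
  Nat.le_zero.1 (N.dist_le_walkWeight (.nil : N.graph.Walk u u))

lemma dist_comm (u v : V) : N.dist u v = N.dist v u := by
  have key : ∀ u v, N.dist u v ≤ N.dist v u := fun u v => by
    obtain ⟨p, hp⟩ := N.exists_walkWeight_eq_dist v u
    rw [← hp, ← walkWeight_reverse]
    exact N.dist_le_walkWeight _
  exact le_antisymm (key u v) (key v u)

lemma dist_triangle (u v w : V) : N.dist u w ≤ N.dist u v + N.dist v w := by
  obtain ⟨p, hp⟩ := N.exists_walkWeight_eq_dist u v
  obtain ⟨q, hq⟩ := N.exists_walkWeight_eq_dist v w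
  rw [← hp, ← hq, ← walkWeight_append]
  exact N.dist_le_walkWeight _

lemma dist_le_weight_add {u v : V} (h : N.graph.Adj u v) (w : V) :
    N.dist u w ≤ N.weight s(u, v) + N.dist v w := by
  obtain ⟨q, hq⟩ := N.exists_walkWeight_eq_dist v w
  rw [← hq, ← N.walkWeight_cons h]
  exact N.dist_le_walkWeight _

lemma exists_isPath_walkWeight_eq_dist (u v : V) :
    ∃ p : N.graph.Walk u v, p.IsPath ∧ N.walkWeight p = N.dist u v := by
  classical
  obtain ⟨p, hp⟩ := N.exists_walkWeight_eq_dist u v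
  refine ⟨p.bypass, p.bypass_isPath, le_antisymm ?_ (N.dist_le_walkWeight _)⟩
  rw [← hp]
  exact (p.edges_bypass_sublist_edges.map N.weight).sum_le_sum (fun _ _ => Nat.zero_le _)

lemma exists_shortest_walk [Fintype V] (u v : V) :
    ∃ p : N.graph.Walk u v, N.walkWeight p = N.dist u v ∧ p.length ≤ N.spDiam := by
  obtain ⟨p, hp, hw⟩ := N.exists_isPath_walkWeight_eq_dist u v
  obtain ⟨q, -, hq, hl⟩ := Nat.sInf_mem (s := {k : ℕ | ∃ p : N.graph.Walk u v,
    p.IsPath ∧ N.walkWeight p = N.dist u v ∧ p.length = k}) ⟨_, p, hp, hw, rfl⟩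
  refine ⟨q, hq, hl.trans_le ?_⟩
  exact (Finset.le_sup (f := fun v => N.hops u v) (Finset.mem_univ v)).trans
    (Finset.le_sup (f := fun u => Finset.univ.sup fun v : V => N.hops u v) (Finset.mem_univ u))

lemma one_le_spDiam [Fintype V] (h : 2 ≤ Fintype.card V) : 1 ≤ N.spDiam := by
  obtain ⟨u, v, huv⟩ := Fintype.exists_pair_of_one_lt_card (α := V) (by omega)
  obtain ⟨p, -, hp⟩ := N.exists_shortest_walk u v
  rcases Nat.eq_zero_or_pos p.length with h0 | h0
  · exact absurd (SimpleGraph.Walk.eq_of_length_eq_zero h0) huv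
  · omega

lemma dist_lt [Fintype V] {c : ℕ} (h : N.PolyBounded c) (u v : V) :
    N.dist u v < Fintype.card V ^ (c + 1) := by
  obtain ⟨p, hp, hw⟩ := N.exists_isPath_walkWeight_eq_dist u v
  have h1 : N.walkWeight p ≤ p.length * Fintype.card V ^ c := by
    have := List.sum_le_card_nsmul (p.edges.map N.weight) (Fintype.card V ^ c) (by
      intro x hx
      obtain ⟨e, he, rfl⟩ := List.mem_map.1 hx
      exact h.2 e (p.edges_subset_edgeSet he))
    simpa [walkWeight] using this
  have h2 := hp.length_lt
  have h3 : 0 < Fintype.card V ^ c := Nat.pow_pos (by omega)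
  calc N.dist u v ≤ p.length * Fintype.card V ^ c := hw ▸ h1
    _ < Fintype.card V * Fintype.card V ^ c := by gcongr
    _ = _ := by ring

/-- The choice in `neighbor` is unique, as identity numbers are distinct. -/
lemma neighbor_ident {u v : V} (h : N.graph.Adj v u) : N.neighbor v (N.ident u) = some u := by
  have hex : ∃ w, N.graph.Adj v w ∧ N.ident w = N.ident u := ⟨u, h, rfl⟩
  rw [neighbor, dif_pos hex]
  exact congrArg some (N.ident_injective hex.choose_spec.2)

lemma neighbor_eq_some {v : V} {x : ℕ} {u : V} :
    N.neighbor v x = some u ↔ N.graph.Adj v u ∧ N.ident u = x := by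
  refine ⟨fun h => ?_, fun ⟨h, hx⟩ => hx ▸ N.neighbor_ident h⟩
  unfold neighbor at h
  split_ifs at h with hex
  have := hex.choose_spec
  simp only [Option.some.injEq] at h
  rwa [h] at this

lemma ncard_adj [Fintype V] : {p : V × V | N.graph.Adj p.1 p.2}.ncard = 2 * N.numEdges := by
  classical
  have h := N.graph.dart_card_eq_twice_card_edges
  rw [numEdges, ← SimpleGraph.coe_edgeFinset, Set.ncard_coe_finset, ← h, ← Nat.card_coe_set_eq,
    ← Nat.card_eq_fintype_card]
  exact Nat.card_congr
    ⟨fun p => ⟨p.1, p.2⟩, fun d => ⟨d.toProd, d.adj⟩, fun _ => rfl, fun _ => rfl⟩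

end Network

/-- In each round, each of the `2 |E|` directed edges carries at most one message. -/
lemma NodeProgram.messageCount_le {V M : Type} [Fintype V] (A : NodeProgram M) (N : Network V)
    (ω : A.Coins V) (T : ℕ) : A.messageCount N ω T ≤ T * (2 * N.numEdges) := by
  unfold messageCount
  refine (Finset.sum_le_card_nsmul _ _ (2 * N.numEdges) fun t _ => ?_).trans_eq (by simp)
  rw [← N.ncard_adj]
  refine Set.ncard_le_ncard (fun p hp => ?_) (Set.toFinite _)
  by_contra hadj
  exact hp (if_neg fun h => hadj h.1)

end DistSketch

/-! ### Programs that broadcast many words per super-round -/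

namespace DistSketch

lemma NodeProgram.run_succ {V M : Type} (A : NodeProgram M) (N : Network V) (ω : A.Coins V)
    (t : ℕ) : A.run N ω (t + 1) = A.round N (A.run N ω t) := rfl

/-- A program for a network in which, in each super-round, a node broadcasts `len` words to all
of its neighbours: `share x k` is the `k`-th word that a node in the state `x` broadcasts.
`step x inbox` is the next state, where `inbox y k` is the `k`-th word of the neighbour with the
identity number `y`, if there is one and `k < len`. -/
structure BroadcastProgram (M : Type) where
  State : Type
  coins : ℕ
  len : ℕ
  init : LocalView → (Fin coins → Bool) → State
  share : State → ℕ → M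
  step : State → (ℕ → ℕ → Option M) → State
  output : State → Option (List M)

namespace BroadcastProgram

variable {M V : Type}

/-- The words that the node `v` gets in a super-round from the neighbours, among those with an
index below `r`. -/
noncomputable def inbox (A : BroadcastProgram M) (N : Network V) (σ : V → A.State) (r : ℕ)
    (v : V) : ℕ → ℕ → Option M :=
  fun y k => if k < r then (N.neighbor v y).map fun u => A.share (σ u) k else none

/-- The states of all nodes after `t` super-rounds, where the outputs are ignored. -/
noncomputable def exec (A : BroadcastProgram M) (N : Network V) (ω : V → Fin A.coins → Bool) :
    ℕ → V → A.State
  | 0 => fun v => A.init (N.view v) (ω v)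
  | t + 1 => fun v => A.step (A.exec N ω t v) (A.inbox N (A.exec N ω t) A.len v)

/-- The node program that sends the words of a super-round one by one. A state consists of
the state of the broadcast program, the index of the next word and the words received so far in
the current super-round. -/
abbrev toNodeProgram (A : BroadcastProgram M) : NodeProgram M where
  State := A.State × ℕ × (ℕ → ℕ → Option M)
  coins := A.coins
  init w b := (A.init w b, 0, fun _ _ => none)
  send x _ := some (A.share x.1 x.2.1)
  receive x f :=
    let inbox : ℕ → ℕ → Option M := fun y k => if k = x.2.1 then f y else x.2.2 y k
    if x.2.1 + 1 < A.len then (x.1, x.2.1 + 1, inbox)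
    else (A.step x.1 inbox, 0, fun _ _ => none)
  output x := A.output x.1

variable (A : BroadcastProgram M) (N : Network V) (ω : V → Fin A.coins → Bool)

lemma round_toNodeProgram (σ : V → A.State) (hσ : ∀ v, A.output (σ v) = none) (r : ℕ) :
    A.toNodeProgram.round N (fun v => (σ v, r, A.inbox N σ r v)) = fun v =>
      if r + 1 < A.len then (σ v, r + 1, A.inbox N σ (r + 1) v)
      else (A.step (σ v) (A.inbox N σ (r + 1) v), 0, fun _ _ => none) := by
  funext v
  have hbox : (fun y k => if k = r then
      (N.neighbor v y).bind fun u =>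
        A.toNodeProgram.message N (fun v => (σ v, r, A.inbox N σ r v)) u v
      else A.inbox N σ r v y k) = A.inbox N σ (r + 1) v := by
    funext y k
    unfold inbox
    rcases lt_trichotomy k r with h | h | h
    · rw [if_neg h.ne, if_pos h, if_pos (by omega)]
    · subst h
      rw [if_pos rfl, if_pos (by omega)]
      cases hy : N.neighbor v y with
      | none => rfl
      | some u =>
        have hadj := (N.neighbor_eq_some.1 hy).1.symm
        simp [NodeProgram.message, hadj, toNodeProgram, hσ]
    · rw [if_neg h.ne', if_neg (by omega), if_neg (by omega)]
  simp only [NodeProgram.round, hσ v]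
  rw [← hbox]

/-- As long as no node halts, `t` super-rounds take `len * t` rounds. -/
lemma run_toNodeProgram (hlen : 0 < A.len) (t : ℕ)
    (h : ∀ s < t, ∀ v, A.output (A.exec N ω s v) = none) :
    A.toNodeProgram.run N ω (A.len * t) = fun v => (A.exec N ω t v, 0, fun _ _ => none) := by
  induction t with
  | zero => rfl
  | succ t ih =>
    have key : ∀ r < A.len, A.toNodeProgram.run N ω (A.len * t + r) =
        fun v => (A.exec N ω t v, r, A.inbox N (A.exec N ω t) r v) := by
      intro r
      induction r with
      | zero =>
        intro _
        rw [add_zero, ih fun s hs => h s (by omega)]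
        rfl
      | succ r ihr =>
        intro hr
        rw [← add_assoc, NodeProgram.run_succ, ihr (by omega),
          A.round_toNodeProgram N _ (h t (by omega))]
        simp [hr]
    obtain ⟨r, hr⟩ : ∃ r, A.len = r + 1 := ⟨A.len - 1, by omega⟩
    have : A.len * (t + 1) = A.len * t + r + 1 := by rw [mul_add, mul_one]; omega
    rw [this, NodeProgram.run_succ, key r (by omega), A.round_toNodeProgram N _ (h t (by omega))]
    funext v
    rw [if_neg (by omega), ← hr]
    rfl

end BroadcastProgram

end DistSketch

/-! ### Truncated distance tables -/

namespace DistSketch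

/-- The order of the identity numbers `y` by `(h y, y)`, lexicographically. -/
def Before (h : ℕ → ℕ∞) (y x : ℕ) : Prop := h y < h x ∨ (h y = h x ∧ y < x)

lemma Before.trans {h : ℕ → ℕ∞} {x y z : ℕ} (h1 : Before h x y) (h2 : Before h y z) :
    Before h x z := by
  rcases h1 with h1 | ⟨h1, h1'⟩ <;> rcases h2 with h2 | ⟨h2, h2'⟩
  · exact .inl (h1.trans h2)
  · exact .inl (h2 ▸ h1)
  · exact .inl (h1 ▸ h2)
  · exact .inr ⟨h1.trans h2, h1'.trans h2'⟩

lemma Before.irrefl {h : ℕ → ℕ∞} {x : ℕ} : ¬ Before h x x := by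
  simp [Before]

lemma Before.le {h : ℕ → ℕ∞} {x y : ℕ} (h1 : Before h x y) : h x ≤ h y := by
  rcases h1 with h1 | ⟨h1, -⟩
  exacts [h1.le, h1.le]

lemma before_or_eq_or_before (h : ℕ → ℕ∞) (x y : ℕ) : Before h x y ∨ x = y ∨ Before h y x := by
  unfold Before
  rcases lt_trichotomy (h x) (h y) with h1 | h1 | h1
  · exact .inl (.inl h1)
  · rcases lt_trichotomy x y with h2 | h2 | h2
    · exact .inl (.inr ⟨h1, h2⟩)
    · exact .inr (.inl h2)
    · exact .inr (.inr (.inr ⟨h1.symm, h2⟩))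
  · exact .inr (.inr (.inl h1))

open Classical in
/-- The number of the `y < Q` that come before `x`. -/
noncomputable def rank (Q : ℕ) (h : ℕ → ℕ∞) (x : ℕ) : ℕ :=
  ((Finset.range Q).filter fun y => Before h y x).card

variable {Q D R : ℕ} {h g : ℕ → ℕ∞} {x y k : ℕ}

lemma rank_lt_rank (hy : y < Q) (hb : Before h y x) : rank Q h y < rank Q h x := by
  classical
  refine Finset.card_lt_card (Finset.ssubset_iff_subset_ne.2 ⟨fun z hz => ?_, fun heq => ?_⟩)
  · simp only [Finset.mem_filter] at hz ⊢
    exact ⟨hz.1, hz.2.trans hb⟩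
  · have : y ∈ (Finset.range Q).filter fun z => Before h z y := by
      rw [heq]; simpa using ⟨hy, hb⟩
    exact Before.irrefl (Finset.mem_filter.1 this).2

lemma rank_injOn : Set.InjOn (rank Q h) {x | x < Q} := by
  intro x hx y hy hxy
  rcases before_or_eq_or_before h x y with hb | hb | hb
  · exact absurd hxy (rank_lt_rank hx hb).ne
  · exact hb
  · exact absurd hxy (rank_lt_rank hy hb).ne'

lemma before_of_rank_lt (hx : x < Q) (hr : rank Q h y < rank Q h x) : Before h y x := by
  rcases before_or_eq_or_before h y x with hb | hb | hb
  · exact hb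
  · exact absurd (hb ▸ hr) (lt_irrefl _)
  · exact absurd (rank_lt_rank hx hb) hr.not_gt

lemma rank_lt (hx : x < Q) : rank Q h x < Q := by
  classical
  calc rank Q h x < (Finset.range Q).card := by
        refine Finset.card_lt_card ((Finset.filter_ssubset).2 ⟨x, by simpa using hx, Before.irrefl⟩)
    _ = Q := Finset.card_range Q

lemma exists_rank_eq (hk : k < Q) : ∃ y < Q, rank Q h y = k := by
  have hmaps : Set.MapsTo (rank Q h) (Finset.range Q : Set ℕ) (Finset.range Q : Set ℕ) :=
    fun x hx => by simpa using rank_lt (by simpa using hx)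
  have hinj : Set.InjOn (rank Q h) (Finset.range Q : Set ℕ) :=
    fun x hx y hy => rank_injOn (by simpa using hx) (by simpa using hy)
  have := Finset.surjOn_of_injOn_of_card_le _ hmaps hinj le_rfl
  obtain ⟨y, hy, hyk⟩ := this (show k ∈ (Finset.range Q : Set ℕ) by simpa using hk)
  exact ⟨y, by simpa using hy, hyk⟩

lemma rank_mono (hb : ∀ z, Before g z y → Before h z x) : rank Q g y ≤ rank Q h x := by
  classical
  exact Finset.card_le_card fun z hz => by
    simp only [Finset.mem_filter] at hz ⊢
    exact ⟨hz.1, hb z hz.2⟩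

/-- The restriction of `h` to the `R` least identity numbers `x < Q` in the order by `(h x, x)`,
as far as the value of `h` is below `D`; other values are replaced by `⊤`. -/
noncomputable def truncate (Q D R : ℕ) (h : ℕ → ℕ∞) (x : ℕ) : ℕ∞ :=
  open Classical in if x < Q ∧ h x < D ∧ rank Q h x < R then h x else ⊤

lemma le_truncate : h x ≤ truncate Q D R h x := by
  unfold truncate
  split_ifs
  exacts [le_rfl, le_top]

/-- The pair `(x, h x)` for the `x` of rank `k`, if it belongs into a truncated table. -/
noncomputable def slot (Q D : ℕ) (h : ℕ → ℕ∞) (k : ℕ) : Option (ℕ × ℕ) :=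
  open Classical in
  if hk : ∃ p : ℕ × ℕ, p.1 < Q ∧ p.2 < D ∧ h p.1 = p.2 ∧ rank Q h p.1 = k
  then some hk.choose else none

lemma slot_eq_some {p : ℕ × ℕ} : slot Q D h k = some p ↔
    p.1 < Q ∧ p.2 < D ∧ h p.1 = p.2 ∧ rank Q h p.1 = k := by
  refine ⟨fun hp => ?_, fun hp => ?_⟩
  · unfold slot at hp
    split_ifs at hp with hk
    have := hk.choose_spec
    simp only [Option.some.injEq] at hp
    rwa [hp] at this
  · have hk : ∃ p : ℕ × ℕ, p.1 < Q ∧ p.2 < D ∧ h p.1 = p.2 ∧ rank Q h p.1 = k := ⟨p, hp⟩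
    rw [slot, dif_pos hk]
    obtain ⟨h1, -, h3, h4⟩ := hk.choose_spec
    have hx : hk.choose.1 = p.1 := rank_injOn h1 hp.1 (h4.trans hp.2.2.2.symm)
    have hd : hk.choose.2 = p.2 := by
      have := h3.symm.trans ((congrArg h hx).trans hp.2.2.1)
      exact_mod_cast this
    exact congrArg some (Prod.ext hx hd)

/-- The table that is given by a list of `R` slots. -/
noncomputable def ofSlots (R : ℕ) (T : ℕ → Option (ℕ × ℕ)) (x : ℕ) : ℕ∞ :=
  ⨅ k < R, ⨅ d : ℕ, ⨅ _ : T k = some (x, d), (d : ℕ∞)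

lemma ofSlots_congr {T T' : ℕ → Option (ℕ × ℕ)} (hT : ∀ k < R, T k = T' k) :
    ofSlots R T = ofSlots R T' := by
  funext x
  exact iInf_congr fun k => iInf_congr fun hk => by rw [hT k hk]

lemma ofSlots_slot : ofSlots R (slot Q D h) = truncate Q D R h := by
  funext x
  apply le_antisymm
  · unfold truncate
    split_ifs with hx
    · obtain ⟨d, hd⟩ := ENat.ne_top_iff_exists.1 hx.2.1.ne_top
      refine (iInf₂_le (rank Q h x) hx.2.2).trans ((iInf₂_le d ?_).trans hd.le)
      refine slot_eq_some.2 ⟨hx.1, ?_, hd.symm, rfl⟩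
      have := hx.2.1
      rw [← hd] at this
      exact_mod_cast this
    · exact le_top
  · refine le_iInf₂ fun k hk => le_iInf₂ fun d hd => ?_
    obtain ⟨h1, h2, h3, h4⟩ := slot_eq_some.1 hd
    simp only at h1 h2 h3 h4
    rw [truncate, if_pos ⟨h1, by rw [h3]; exact_mod_cast h2, h4 ▸ hk⟩, h3]

lemma rank_le_rank_of_le (hle : ∀ y, h y ≤ g y) (hx : g x = h x) : rank Q g x ≤ rank Q h x := by
  refine rank_mono fun y hb => ?_
  rcases hb with hb | ⟨hb, hxy⟩
  · exact .inl ((hle y).trans_lt (hx ▸ hb))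
  · rcases ((hle y).trans (hb.trans hx).le).lt_or_eq with h1 | h1
    exacts [.inl h1, .inr ⟨h1, hxy⟩]

/-- If a table `g` of overestimates of `h` is exact at the `R` least places of `h`, then it has
the same truncation. -/
lemma truncate_eq_truncate (hle : ∀ y, h y ≤ g y)
    (heq : ∀ y < Q, rank Q h y < R → g y = h y) : truncate Q D R g = truncate Q D R h := by
  classical
  funext x
  unfold truncate
  by_cases hx : x < Q
  swap
  · simp [hx]
  by_cases hr : rank Q h x < R
  · have hgx := heq x hx hr
    have hr' : rank Q g x < R := (rank_le_rank_of_le hle hgx).trans_lt hr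
    simp [hgx, hr, hr']
  · -- The `R` least places of `h` come before `x` in `g` as well.
    have hr' : R ≤ rank Q g x := by
      push Not at hr
      calc R = (Finset.range R).card := (Finset.card_range R).symm
        _ ≤ (((Finset.range Q).filter fun y => Before g y x).image (rank Q h)).card := by
          refine Finset.card_le_card fun k hk => ?_
          have hk' := Finset.mem_range.1 hk
          obtain ⟨y, hy, rfl⟩ := exists_rank_eq (h := h) (hk'.trans (hr.trans_lt (rank_lt hx)))
          refine Finset.mem_image_of_mem _ (Finset.mem_filter.2 ⟨Finset.mem_range.2 hy, ?_⟩)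
          have hyg := heq y hy hk'
          rcases before_of_rank_lt hx (hk'.trans_le hr) with hb | ⟨hb, hxy⟩
          · exact .inl (hyg ▸ hb.trans_le (hle x))
          · rcases (hyg.le.trans (hb.le.trans (hle x))).lt_or_eq with h1 | h1
            exacts [.inl h1, .inr ⟨h1, hxy⟩]
        _ ≤ rank Q g x := Finset.card_image_le
    rw [if_neg fun h1 => hr'.not_gt h1.2.2, if_neg fun h1 => hr h1.2.2]

end DistSketch

/-! ### The sketching program -/

namespace DistSketch

/-- The parameters of the sketching program: bounds on identity numbers and distances, the
size `slots` of the distance tables, the number `top` of the highest level, and a code that packs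
a table entry (an identity number and a distance), an identity number and a flag into one word. -/
structure Params (M : Type) where
  idBound : ℕ
  distBound : ℕ
  slots : ℕ
  top : ℕ
  encode : Option (ℕ × ℕ) × ℕ × Prop → M
  decode : M → Option (ℕ × ℕ) × ℕ × Prop
  decode_encode : ∀ e : Option (ℕ × ℕ) × ℕ × Prop,
    (∀ p, e.1 = some p → p.1 < idBound ∧ p.2 < distBound) → e.2.1 < idBound →
      decode (encode e) = e

/-- The state of a node. `lvl j` says that the node belongs to the `j`-th level, and `table j` is
its present table of distances to the nodes of the `j`-th level. The remaining components serve to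
detect termination, in phases with growing guesses `guess` for the shortest-path diameter:
`tick` counts the super-rounds of the phase, `root` is the least identity number seen in the phase,
`bad` is the objection against halting at the end of the phase, and `done` is the decision. -/
structure NodeState where
  view : LocalView
  lvl : ℕ → Prop
  table : ℕ → ℕ → ℕ∞
  root : ℕ
  bad : Prop
  guess : ℕ
  tick : ℕ
  done : Prop

/-- The first `j` coins show heads. -/
def Heads {top : ℕ} (b : Fin top → Bool) (j : ℕ) : Prop := ∀ i : Fin top, (i : ℕ) < j → b i = true

namespace Params

variable {M V : Type} (P : Params M)

/-- The table of the `j`-th level that is contained in a sequence of words. -/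
noncomputable def readTable (W : ℕ → Option M) (j : ℕ) : ℕ → ℕ∞ :=
  ofSlots P.slots fun k => (W (j * P.slots + k)).bind fun w => (P.decode w).1

/-- The `p`-th word that a node broadcasts. -/
noncomputable def share (x : NodeState) (p : ℕ) : M :=
  P.encode (slot P.idBound P.distBound (x.table (p / P.slots)) (p % P.slots), x.root, x.bad)

open Classical in
/-- The Bellman–Ford update of the distance tables. -/
noncomputable def nextTable (x : NodeState) (b : ℕ → ℕ → Option M) (j y : ℕ) : ℕ∞ :=
  (if x.lvl j ∧ y = x.view.ident then 0 else ⊤) ⊓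
    ⨅ z, ⨅ w : ℕ, ⨅ _ : x.view.nbrWeight z = some w, (w : ℕ∞) + P.readTable (b z) j y

/-- The truncated table of the `j`-th level. -/
noncomputable def cut (T : ℕ → ℕ → ℕ∞) (j : ℕ) : ℕ → ℕ∞ :=
  truncate P.idBound P.distBound P.slots (T j)

open Classical in
/-- A super-round. The tables are always updated. A phase with the guess `g` has four parts: in `g`
super-rounds the least identity number is flooded; then a node objects if a neighbour has seen
another least identity number or if one of its own tables still changes; in `2 * g` super-rounds
the objections are flooded; and then a node decides to halt unless it knows of an objection. -/
noncomputable def step (x : NodeState) (b : ℕ → ℕ → Option M) : NodeState :=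
  if x.tick < x.guess then
    { x with
      table := P.nextTable x b
      root := sInf {r | r = x.root ∨ ∃ z w, b z 0 = some w ∧ r = (P.decode w).2.1}
      tick := x.tick + 1 }
  else if x.tick = x.guess then
    { x with
      table := P.nextTable x b
      bad := (∃ z w, b z 0 = some w ∧ (P.decode w).2.1 ≠ x.root) ∨
        ∃ j ≤ P.top, P.cut (P.nextTable x b) j ≠ P.cut x.table j
      tick := x.tick + 1 }
  else if x.tick ≤ 3 * x.guess then
    { x with
      table := P.nextTable x b
      bad := x.bad ∨ ∃ z w, b z 0 = some w ∧ (P.decode w).2.2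
      tick := x.tick + 1 }
  else
    { x with
      table := P.nextTable x b
      root := x.view.ident
      bad := False
      guess := 2 * x.guess
      tick := 0
      done := ¬ x.bad }

/-- The number of words that a node broadcasts in a super-round. -/
def len : ℕ := (P.top + 1) * P.slots

open Classical in
/-- The sketching program. A node belongs to the `j`-th level if its first `j` coins show heads. -/
noncomputable abbrev program : BroadcastProgram M where
  State := NodeState
  coins := P.top
  len := P.len
  init w b :=
    { view := w
      lvl := Heads b
      table := fun _ _ => ⊤
      root := w.ident
      bad := False
      guess := 1
      tick := 0
      done := False }
  share := P.share
  step := P.step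
  output x := if x.done then some ((List.range P.len).map (P.share x)) else none

/-- The nodes of the `j`-th level. -/
def level (ω : V → Fin P.top → Bool) (j : ℕ) (v : V) : Prop := Heads (ω v) j

variable (N : Network V) (ω : V → Fin P.top → Bool)

/-- The state of `v` after `t` super-rounds. -/
noncomputable abbrev st (t : ℕ) (v : V) : NodeState := P.program.exec N ω t v

/-- The words that `v` gets in the super-round after the first `t` ones. -/
noncomputable abbrev mail (t : ℕ) (v : V) : ℕ → ℕ → Option M :=
  P.program.inbox N (P.st N ω t) P.len v

lemma st_succ (t : ℕ) (v : V) : P.st N ω (t + 1) v = P.step (P.st N ω t v) (P.mail N ω t v) := rfl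

lemma step_view (x : NodeState) (b : ℕ → ℕ → Option M) : (P.step x b).view = x.view := by
  unfold step; split_ifs <;> rfl

lemma step_lvl (x : NodeState) (b : ℕ → ℕ → Option M) : (P.step x b).lvl = x.lvl := by
  unfold step; split_ifs <;> rfl

lemma step_table (x : NodeState) (b : ℕ → ℕ → Option M) :
    (P.step x b).table = P.nextTable x b := by
  unfold step; split_ifs <;> rfl

lemma st_view (t : ℕ) (v : V) : (P.st N ω t v).view = N.view v := by
  induction t with
  | zero => rfl
  | succ t ih => rw [st_succ, step_view, ih]

lemma st_lvl (t : ℕ) (v : V) (j : ℕ) : (P.st N ω t v).lvl j = P.level ω j v := by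
  induction t with
  | zero => rfl
  | succ t ih => rw [st_succ, step_lvl, ih]

lemma mail_eq_some {t : ℕ} {v : V} {z k : ℕ} {w : M} : P.mail N ω t v z k = some w ↔
    k < P.len ∧ ∃ u, N.graph.Adj v u ∧ N.ident u = z ∧ w = P.share (P.st N ω t u) k := by
  simp only [mail, BroadcastProgram.inbox]
  split_ifs with hk
  · simp only [hk, true_and, Option.map_eq_some_iff, N.neighbor_eq_some, and_assoc,
      eq_comm (a := w)]
  · simp [hk]

variable {P N} (hid : ∀ v, N.ident v < P.idBound) (hR : 0 < P.slots)

include hR in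
lemma len_pos : 0 < P.len := Nat.mul_pos (Nat.succ_pos _) hR

lemma decode_share {x : NodeState} (hx : x.root < P.idBound) (p : ℕ) :
    P.decode (P.share x p) =
      (slot P.idBound P.distBound (x.table (p / P.slots)) (p % P.slots), x.root, x.bad) := by
  refine P.decode_encode _ (fun q hq => ?_) hx
  have := slot_eq_some.1 hq
  exact ⟨this.1, this.2.1⟩

include hid in
lemma exists_root_eq (t : ℕ) (v : V) : ∃ u, (P.st N ω t v).root = N.ident u := by
  induction t generalizing v with
  | zero => exact ⟨v, rfl⟩
  | succ t ih =>
    rw [st_succ]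
    unfold step
    split_ifs with h1 h2 h3
    · simp only
      rcases Nat.sInf_mem (s := {r | r = (P.st N ω t v).root ∨
        ∃ z w, P.mail N ω t v z 0 = some w ∧ r = (P.decode w).2.1}) ⟨_, .inl rfl⟩ with h | h
      · rw [h]; exact ih v
      · obtain ⟨z, w, hw, h⟩ := h
        obtain ⟨-, u, -, -, rfl⟩ := (P.mail_eq_some N ω).1 hw
        obtain ⟨u', hu'⟩ := ih u
        rw [decode_share (hu' ▸ hid u')] at h
        exact ⟨u', h.trans hu'⟩
    · exact ih v
    · exact ih v
    · exact ⟨v, by simp only [st_view]; rfl⟩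

include hid in
lemma decode_share_st (t : ℕ) (v : V) (p : ℕ) : P.decode (P.share (P.st N ω t v) p) =
    (slot P.idBound P.distBound ((P.st N ω t v).table (p / P.slots)) (p % P.slots),
      (P.st N ω t v).root, (P.st N ω t v).bad) := by
  obtain ⟨u, hu⟩ := exists_root_eq ω hid t v
  exact decode_share (hu ▸ hid u) p

/-- The words that a node broadcasts contain its truncated tables. -/
lemma readTable_share {x : NodeState} (hx : x.root < P.idBound) {W : ℕ → Option M}
    (hW : ∀ p < P.len, W p = some (P.share x p)) {j : ℕ} (hj : j ≤ P.top) :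
    P.readTable W j = P.cut x.table j := by
  rw [cut, ← ofSlots_slot, readTable]
  refine ofSlots_congr fun k hk => ?_
  have hlt : j * P.slots + k < P.len := by
    calc j * P.slots + k < j * P.slots + P.slots := by omega
      _ = (j + 1) * P.slots := by ring
      _ ≤ P.len := Nat.mul_le_mul_right _ (by omega)
  have hdiv : (j * P.slots + k) / P.slots = j := by
    rw [mul_comm, Nat.mul_add_div (by omega), Nat.div_eq_of_lt hk, add_zero]
  have hmod : (j * P.slots + k) % P.slots = k := by
    rw [mul_comm, Nat.mul_add_mod, Nat.mod_eq_of_lt hk]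
  rw [hW _ hlt, Option.bind_some, decode_share hx, hdiv, hmod]

open Classical in
include hid in
lemma table_succ (t : ℕ) (v : V) {j : ℕ} (hj : j ≤ P.top) (y : ℕ) :
    (P.st N ω (t + 1) v).table j y = (if P.level ω j v ∧ y = N.ident v then 0 else ⊤) ⊓
      ⨅ u, ⨅ _ : N.graph.Adj v u, (N.weight s(v, u) : ℕ∞) + P.cut (P.st N ω t u).table j y := by
  have hread : ∀ u, N.graph.Adj v u →
      P.readTable (P.mail N ω t v (N.ident u)) j = P.cut (P.st N ω t u).table j := by
    intro u hu
    obtain ⟨u', hu'⟩ := exists_root_eq ω hid t u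
    exact readTable_share (hu' ▸ hid u')
      (fun p hp => (P.mail_eq_some N ω).2 ⟨hp, u, hu, rfl, rfl⟩) hj
  rw [st_succ, step_table, nextTable, st_view, st_lvl]
  refine congrArg₂ _ rfl (le_antisymm ?_ ?_)
  · refine le_iInf₂ fun u hu => ?_
    refine (iInf_le _ (N.ident u)).trans ((iInf₂_le (N.weight s(v, u)) ?_).trans ?_)
    · simp [Network.view, N.neighbor_ident hu]
    · rw [hread u hu]
  · refine le_iInf fun z => le_iInf₂ fun w hw => ?_
    obtain ⟨u, hu, rfl⟩ := Option.map_eq_some_iff.1 hw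
    obtain ⟨hadj, rfl⟩ := N.neighbor_eq_some.1 hu
    rw [hread u hadj]
    exact iInf₂_le u hadj

include hid hR in
lemma st_succ_of_tick_lt {t : ℕ} {v : V} (h : (P.st N ω t v).tick < (P.st N ω t v).guess) :
    P.st N ω (t + 1) v = { P.st N ω t v with
      table := (P.st N ω (t + 1) v).table
      root := sInf {r | r = (P.st N ω t v).root ∨
        ∃ u, N.graph.Adj v u ∧ r = (P.st N ω t u).root}
      tick := (P.st N ω t v).tick + 1 } := by
  conv_lhs => rw [st_succ, step, if_pos h]
  rw [st_succ, step_table]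
  congr 2
  ext r
  simp only [Set.mem_ofPred_eq, mail_eq_some]
  refine or_congr Iff.rfl ⟨?_, ?_⟩
  · rintro ⟨z, w, ⟨-, u, hu, -, rfl⟩, h⟩
    exact ⟨u, hu, by rw [h, decode_share_st ω hid]⟩
  · rintro ⟨u, hu, h⟩
    exact ⟨_, _, ⟨len_pos hR, u, hu, rfl, rfl⟩, by rw [h, decode_share_st ω hid]⟩

include hid hR in
lemma st_succ_of_tick_eq {t : ℕ} {v : V} (h : (P.st N ω t v).tick = (P.st N ω t v).guess) :
    P.st N ω (t + 1) v = { P.st N ω t v with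
      table := (P.st N ω (t + 1) v).table
      bad := (∃ u, N.graph.Adj v u ∧ (P.st N ω t u).root ≠ (P.st N ω t v).root) ∨
        ∃ j ≤ P.top, P.cut (P.st N ω (t + 1) v).table j ≠ P.cut (P.st N ω t v).table j
      tick := (P.st N ω t v).tick + 1 } := by
  conv_lhs => rw [st_succ, step, if_neg h.not_lt, if_pos h]
  rw [st_succ, step_table]
  congr 1
  refine propext (or_congr ⟨?_, ?_⟩ Iff.rfl)
  · rintro ⟨z, w, hw, h⟩
    obtain ⟨-, u, hu, -, rfl⟩ := (P.mail_eq_some N ω).1 hw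
    rw [decode_share_st ω hid] at h
    exact ⟨u, hu, h⟩
  · rintro ⟨u, hu, h⟩
    exact ⟨_, _, (P.mail_eq_some N ω).2 ⟨len_pos hR, u, hu, rfl, rfl⟩,
      by rwa [decode_share_st ω hid]⟩

include hid hR in
lemma st_succ_of_lt_tick {t : ℕ} {v : V} (h : (P.st N ω t v).guess < (P.st N ω t v).tick)
    (h' : (P.st N ω t v).tick ≤ 3 * (P.st N ω t v).guess) :
    P.st N ω (t + 1) v = { P.st N ω t v with
      table := (P.st N ω (t + 1) v).table
      bad := (P.st N ω t v).bad ∨ ∃ u, N.graph.Adj v u ∧ (P.st N ω t u).bad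
      tick := (P.st N ω t v).tick + 1 } := by
  conv_lhs => rw [st_succ, step, if_neg h.not_gt, if_neg h.ne', if_pos h']
  rw [st_succ, step_table]
  congr 1
  refine propext (or_congr Iff.rfl ⟨?_, ?_⟩)
  · rintro ⟨z, w, hw, h⟩
    obtain ⟨-, u, hu, -, rfl⟩ := (P.mail_eq_some N ω).1 hw
    rw [decode_share_st ω hid] at h
    exact ⟨u, hu, h⟩
  · rintro ⟨u, hu, h⟩
    exact ⟨_, _, (P.mail_eq_some N ω).2 ⟨len_pos hR, u, hu, rfl, rfl⟩,
      by rwa [decode_share_st ω hid]⟩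

lemma st_succ_of_phase_end {t : ℕ} {v : V}
    (h : 3 * (P.st N ω t v).guess < (P.st N ω t v).tick) :
    P.st N ω (t + 1) v = { P.st N ω t v with
      table := (P.st N ω (t + 1) v).table
      root := N.ident v
      bad := False
      guess := 2 * (P.st N ω t v).guess
      tick := 0
      done := ¬ (P.st N ω t v).bad } := by
  conv_lhs => rw [st_succ, step, if_neg (by omega), if_neg (by omega), if_neg (by omega)]
  have hv : (P.st N ω t v).view.ident = N.ident v := by rw [st_view]; rfl
  rw [st_succ, step_table, ← hv]

end Params

end DistSketch

/-! ### The tables become exact -/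

namespace DistSketch

namespace Network

variable {V : Type} (N : Network V)

/-- The table of the distances from `v` to the nodes with the property `A`, by identity number. -/
noncomputable def distTable (A : V → Prop) (v : V) (x : ℕ) : ℕ∞ :=
  ⨅ w, ⨅ _ : A w ∧ N.ident w = x, (N.dist v w : ℕ∞)

variable {N} {A : V → Prop}

lemma distTable_ident {w : V} (hw : A w) (v : V) : N.distTable A v (N.ident w) = N.dist v w := by
  refine le_antisymm (iInf₂_le w ⟨hw, rfl⟩) (le_iInf₂ fun u hu => ?_)
  rw [N.ident_injective hu.2]

lemma exists_of_distTable_ne_top {v : V} {x : ℕ} (h : N.distTable A v x ≠ ⊤) :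
    ∃ w, A w ∧ N.ident w = x := by
  by_contra hne
  exact h (iInf₂_eq_top.2 fun w hw => absurd ⟨w, hw⟩ hne)

lemma distTable_le_weight_add {u v : V} (h : N.graph.Adj v u) (x : ℕ) :
    N.distTable A v x ≤ N.weight s(v, u) + N.distTable A u x := by
  by_cases htop : N.distTable A u x = ⊤
  · simp [htop]
  · obtain ⟨w, hw, rfl⟩ := exists_of_distTable_ne_top htop
    rw [distTable_ident hw, distTable_ident hw]
    exact_mod_cast N.dist_le_weight_add h w

/-- If `u` follows `v` on a shortest path from `v` to `w`, then every node that is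
nearer to `u` than `w` is nearer to `v` than `w`. -/
lemma rank_distTable_le {Q : ℕ} {u v w : V} (h : N.graph.Adj v u) (hw : A w)
    (hd : N.dist v w = N.weight s(v, u) + N.dist u w) :
    rank Q (N.distTable A u) (N.ident w) ≤ rank Q (N.distTable A v) (N.ident w) := by
  refine rank_mono fun y hy => ?_
  have hle := distTable_le_weight_add (A := A) h y
  have hvw : N.distTable A v (N.ident w) =
      N.weight s(v, u) + N.distTable A u (N.ident w) := by
    rw [distTable_ident hw, distTable_ident hw]
    exact_mod_cast hd
  rcases hy with hy | ⟨hy, hxy⟩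
  · left
    rw [hvw]
    exact hle.trans_lt ((ENat.add_lt_add_iff_left (ENat.natCast_ne_top _)).2 hy)
  · rw [hy, ← hvw] at hle
    rcases hle.lt_or_eq with h1 | h1
    exacts [.inl h1, .inr ⟨h1, hxy⟩]

end Network

namespace Params

open Network

variable {M V : Type} {P : Params M} {N : Network V} (ω : V → Fin P.top → Bool)
variable (hid : ∀ v, N.ident v < P.idBound) (hR : 0 < P.slots)

include hid in
lemma distTable_le_table (t : ℕ) (v : V) {j : ℕ} (hj : j ≤ P.top) (x : ℕ) :
    N.distTable (P.level ω j) v x ≤ (P.st N ω t v).table j x := by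
  induction t generalizing v with
  | zero => exact le_top
  | succ t ih =>
    rw [table_succ ω hid t v hj]
    refine le_inf ?_ (le_iInf₂ fun u hu => ?_)
    · split_ifs with h
      · rw [h.2, distTable_ident h.1, N.dist_self]
        rfl
      · exact le_top
    · exact (distTable_le_weight_add hu x).trans (by gcongr; exact (ih u).trans le_truncate)

include hid in
/-- The correctness of the Bellman–Ford updates on truncated tables: only the `slots` nearest nodes
matter for the computation of the `slots` nearest nodes. -/
lemma table_eq_dist (hD : ∀ u v, N.dist u v < P.distBound) {j : ℕ} (hj : j ≤ P.top) {v w : V}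
    (hw : P.level ω j w) (p : N.graph.Walk v w) (hp : N.walkWeight p = N.dist v w)
    (t : ℕ) (ht : p.length < t)
    (hrank : rank P.idBound (N.distTable (P.level ω j) v) (N.ident w) < P.slots) :
    (P.st N ω t v).table j (N.ident w) = N.dist v w := by
  induction p generalizing t with
  | nil =>
    obtain ⟨t, rfl⟩ : ∃ s, t = s + 1 := ⟨t - 1, by omega⟩
    rw [table_succ ω hid t _ hj, if_pos ⟨hw, rfl⟩, N.dist_self]
    simp
  | @cons v u w h q ih =>
    obtain ⟨t, rfl⟩ : ∃ s, t = s + 1 := ⟨t - 1, by omega⟩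
    have hq : N.walkWeight q = N.dist u w := by
      refine le_antisymm ?_ (N.dist_le_walkWeight q)
      have := N.dist_le_weight_add h w
      rw [walkWeight_cons] at hp
      omega
    have hd : N.dist v w = N.weight s(v, u) + N.dist u w := by rw [← hp, walkWeight_cons, hq]
    have hrank' := (rank_distTable_le (Q := P.idBound) h hw hd).trans_lt hrank
    have htable := ih hw hq t (by simpa using ht) hrank'
    have hle := distTable_le_table ω hid t u hj
    have hcut : P.cut (P.st N ω t u).table j (N.ident w) = N.dist u w := by
      rw [cut, truncate, if_pos, htable]
      refine ⟨hid w, ?_, (rank_le_rank_of_le hle ?_).trans_lt hrank'⟩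
      · rw [htable]; exact_mod_cast hD u w
      · rw [htable, distTable_ident hw]
    refine le_antisymm ?_ ((distTable_ident hw v).symm.trans_le
      (distTable_le_table ω hid (t + 1) v hj _))
    rw [table_succ ω hid t v hj]
    refine inf_le_right.trans ((iInf₂_le u h).trans ?_)
    rw [hcut, hd]
    norm_cast

include hid in
lemma cut_eq_truncate_distTable [Fintype V] (hD : ∀ u v, N.dist u v < P.distBound) {t : ℕ}
    (ht : N.spDiam < t) (v : V) {j : ℕ} (hj : j ≤ P.top) :
    P.cut (P.st N ω t v).table j =
      truncate P.idBound P.distBound P.slots (N.distTable (P.level ω j) v) := by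
  refine truncate_eq_truncate (distTable_le_table ω hid t v hj) fun x _ hx => ?_
  by_cases htop : N.distTable (P.level ω j) v x = ⊤
  · rw [htop]
    exact top_le_iff.1 (htop ▸ distTable_le_table ω hid t v hj x)
  · obtain ⟨w, hw, rfl⟩ := exists_of_distTable_ne_top htop
    obtain ⟨p, hp, hl⟩ := N.exists_shortest_walk v w
    rw [distTable_ident hw]
    exact table_eq_dist ω hid hD hj hw p hp t (by omega) hx

variable (N) in
/-- After super-round `t + 1`, every truncated table is the same as one super-round before. -/
def Stable (t : ℕ) : Prop :=
  ∀ v, ∀ j ≤ P.top, P.cut (P.st N ω (t + 1) v).table j = P.cut (P.st N ω t v).table j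

variable {ω}

include hid in
lemma Stable.add {t : ℕ} (h : Stable N ω t) (k : ℕ) : Stable N ω (t + k) := by
  induction k with
  | zero => exact h
  | succ k ih =>
    intro v j hj
    have : (P.st N ω (t + (k + 1) + 1) v).table j = (P.st N ω (t + (k + 1)) v).table j := by
      funext y
      rw [table_succ ω hid _ v hj, ← add_assoc, table_succ ω hid _ v hj]
      congr 1
      exact iInf_congr fun u => iInf_congr fun _ => by rw [ih u j hj]
    rw [cut, this, cut]

include hid in
/-- Tables that have stopped changing everywhere are exact, as they are equal to later tables. -/
lemma Stable.cut_eq [Fintype V] (hD : ∀ u v, N.dist u v < P.distBound) {t : ℕ}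
    (h : Stable N ω t) (v : V) {j : ℕ} (hj : j ≤ P.top) {s : ℕ} (hs : t ≤ s) :
    P.cut (P.st N ω s v).table j =
      truncate P.idBound P.distBound P.slots (N.distTable (P.level ω j) v) := by
  have key : ∀ k, P.cut (P.st N ω (t + k) v).table j = P.cut (P.st N ω t v).table j := by
    intro k
    induction k with
    | zero => rfl
    | succ k ih => exact (h.add hid k v j hj).trans ih
  obtain ⟨k, rfl⟩ := Nat.exists_eq_add_of_le hs
  rw [key k, ← key (N.spDiam + 1),
    cut_eq_truncate_distTable ω hid hD (by omega) v hj]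

include hid in
lemma stable_of_spDiam_lt [Fintype V] (hD : ∀ u v, N.dist u v < P.distBound) {t : ℕ}
    (ht : N.spDiam < t) : Stable N ω t := fun v j hj => by
  rw [cut_eq_truncate_distTable ω hid hD ht v hj,
    cut_eq_truncate_distTable ω hid hD (ht.trans t.lt_succ_self) v hj]

/-! ### The detection of termination -/

variable (N ω) in
/-- Super-round `t` begins a phase with the guess `g`, and no node has decided to halt. -/
def PhaseStart (t g : ℕ) : Prop :=
  ∀ v, (P.st N ω t v).root = N.ident v ∧ ¬ (P.st N ω t v).bad ∧ (P.st N ω t v).guess = g ∧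
    (P.st N ω t v).tick = 0 ∧ ¬ (P.st N ω t v).done

variable (N ω) in
/-- Super-round `t` is tick `i` of a phase with the guess `g`, and `v` has not decided to halt. -/
def AtTick (t i g : ℕ) (v : V) : Prop :=
  (P.st N ω t v).tick = i ∧ (P.st N ω t v).guess = g ∧ ¬ (P.st N ω t v).done

variable (N ω) in
/-- The node `v` objects in super-round `t` against halting. -/
def Objects (t : ℕ) (v : V) : Prop :=
  (∃ u, N.graph.Adj v u ∧ (P.st N ω t u).root ≠ (P.st N ω t v).root) ∨
    ∃ j ≤ P.top, P.cut (P.st N ω (t + 1) v).table j ≠ P.cut (P.st N ω t v).table j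

variable {t g : ℕ}

include hid hR in
/-- After `i ≤ g` ticks of a phase, `root` is the least identity number within distance `i`, where
distances are numbers of edges. -/
lemma PhaseStart.flood_root (h : PhaseStart N ω t g) (i : ℕ) (hi : i ≤ g) (v : V) :
    AtTick N ω (t + i) i g v ∧
    (∃ u, ∃ p : N.graph.Walk v u, p.length ≤ i ∧ (P.st N ω (t + i) v).root = N.ident u) ∧
    ∀ u, ∀ p : N.graph.Walk v u, p.length ≤ i → (P.st N ω (t + i) v).root ≤ N.ident u := by
  induction i generalizing v with
  | zero =>
    obtain ⟨h1, h2, h3, h4, h5⟩ := h v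
    refine ⟨⟨h4, h3, h5⟩, ⟨v, .nil, le_rfl, h1⟩, fun u p hp => ?_⟩
    obtain rfl := SimpleGraph.Walk.eq_of_length_eq_zero (Nat.le_zero.1 hp)
    exact h1.le
  | succ i ih =>
    have ih := ih (by omega)
    obtain ⟨⟨h1, h2, h3⟩, h4, h5⟩ := ih v
    have hs := st_succ_of_tick_lt ω hid hR (t := t + i) (v := v) (by omega)
    have hroot := congrArg NodeState.root hs
    simp only at hroot
    have hroot_le : ∀ r, (r = (P.st N ω (t + i) v).root ∨
        ∃ u, N.graph.Adj v u ∧ r = (P.st N ω (t + i) u).root) →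
        (P.st N ω (t + i + 1) v).root ≤ r := fun r hr => hroot ▸ Nat.sInf_le hr
    rw [← add_assoc]
    refine ⟨⟨?_, ?_, ?_⟩, ?_, ?_⟩
    · rw [hs]; exact congrArg (· + 1) h1
    · rw [hs]; exact h2
    · rw [hs]; exact h3
    · rcases hroot ▸ Nat.sInf_mem (s := {r | r = (P.st N ω (t + i) v).root ∨
        ∃ u, N.graph.Adj v u ∧ r = (P.st N ω (t + i) u).root}) ⟨_, .inl rfl⟩ with hr | ⟨u, hu, hr⟩
      · obtain ⟨w, p, hp, hw⟩ := h4
        exact ⟨w, p, by omega, hr.trans hw⟩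
      · obtain ⟨w, p, hp, hw⟩ := (ih u).2.1
        exact ⟨w, .cons hu p, by simpa using hp, hr.trans hw⟩
    · intro u p hp
      cases p with
      | nil => exact (hroot_le _ (.inl rfl)).trans (h5 v .nil (by simp))
      | cons hadj q =>
        exact (hroot_le _ (.inr ⟨_, hadj, rfl⟩)).trans ((ih _).2.2 u q (by simpa using hp))

include hid hR in
/-- A node hears in `i` ticks of the objections within distance `i`. -/
lemma PhaseStart.flood_bad (h : PhaseStart N ω t g) (i : ℕ) (hi : i ≤ 2 * g) (v : V) :
    AtTick N ω (t + g + 1 + i) (g + 1 + i) g v ∧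
    ((P.st N ω (t + g + 1 + i) v).bad ↔
      ∃ u, ∃ p : N.graph.Walk v u, p.length ≤ i ∧ Objects N ω (t + g) u) := by
  induction i generalizing v with
  | zero =>
    obtain ⟨⟨h1, h2, h3⟩, -⟩ := h.flood_root hid hR g le_rfl v
    have hs := st_succ_of_tick_eq ω hid hR (t := t + g) (v := v) (by omega)
    have hbad := congrArg NodeState.bad hs
    simp only at hbad
    refine ⟨⟨?_, ?_, ?_⟩, ?_⟩
    · rw [add_zero, hs]; exact congrArg (· + 1) h1
    · rw [add_zero, hs]; exact h2
    · rw [add_zero, hs]; exact h3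
    · rw [add_zero, hbad]
      refine ⟨fun ho => ⟨v, .nil, le_rfl, ho⟩, fun ⟨u, p, hp, ho⟩ => ?_⟩
      obtain rfl := SimpleGraph.Walk.eq_of_length_eq_zero (Nat.le_zero.1 hp)
      exact ho
  | succ i ih =>
    have ih := ih (by omega)
    obtain ⟨⟨h1, h2, h3⟩, h4⟩ := ih v
    have hs := st_succ_of_lt_tick ω hid hR (t := t + g + 1 + i) (v := v) (by omega) (by omega)
    have hbad := congrArg NodeState.bad hs
    simp only at hbad
    rw [← add_assoc]
    refine ⟨⟨?_, ?_, ?_⟩, ?_⟩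
    · rw [hs]; exact congrArg (· + 1) h1
    · rw [hs]; exact h2
    · rw [hs]; exact h3
    · rw [hbad, h4]
      constructor
      · rintro (⟨u, p, hp, ho⟩ | ⟨u, hu, hb⟩)
        · exact ⟨u, p, by omega, ho⟩
        · obtain ⟨w, p, hp, ho⟩ := (ih u).2.1 hb
          exact ⟨w, .cons hu p, by simpa using hp, ho⟩
      · rintro ⟨u, p, hp, ho⟩
        cases p with
        | nil => exact .inl ⟨v, .nil, by simp, ho⟩
        | cons hadj q => exact .inr ⟨_, hadj, (ih _).2.2 ⟨u, q, by simpa using hp, ho⟩⟩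

include hid hR in
/-- A node `v` such that no node within distance `2 * g` objects has seen the whole network: the
nodes that have seen the same least identity number are within distance `g` of its owner, hence
within distance `2 * g`, so none of them has a neighbour that has seen another one. -/
lemma PhaseStart.not_objects (h : PhaseStart N ω t g) {v : V}
    (hv : ∀ u, ∀ p : N.graph.Walk v u, p.length ≤ 2 * g → ¬ Objects N ω (t + g) u) (u : V) :
    ¬ Objects N ω (t + g) u := by
  have near : ∀ x, (P.st N ω (t + g) x).root = (P.st N ω (t + g) v).root →
      ¬ Objects N ω (t + g) x := by
    intro x hx
    obtain ⟨-, ⟨z, p, hp, hz⟩, -⟩ := h.flood_root hid hR g le_rfl x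
    obtain ⟨-, ⟨z', p', hp', hz'⟩, -⟩ := h.flood_root hid hR g le_rfl v
    obtain rfl : z = z' := N.ident_injective (hz.symm.trans (hx.trans hz'))
    refine hv x (p'.append p.reverse) ?_
    rw [SimpleGraph.Walk.length_append, SimpleGraph.Walk.length_reverse]
    omega
  have same : ∀ {x y : V}, N.graph.Walk x y →
      (P.st N ω (t + g) x).root = (P.st N ω (t + g) v).root →
      (P.st N ω (t + g) y).root = (P.st N ω (t + g) v).root := by
    intro x y p
    induction p with
    | nil => exact id
    | cons hadj q ih =>
      refine fun hx => ih ?_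
      by_contra hne
      exact near _ hx (.inl ⟨_, hadj, fun heq => hne (heq.trans hx)⟩)
  exact near u (same (N.connected.preconnected v u).some rfl)

/-- All nodes have decided to halt in super-round `t`, none of them earlier, and their truncated
tables are exact. -/
structure Finished (N : Network V) (ω : V → Fin P.top → Bool) (t : ℕ) : Prop where
  not_done : ∀ s < t, ∀ v, ¬ (P.st N ω s v).done
  done : ∀ v, (P.st N ω t v).done
  cut_eq : ∀ v, ∀ j ≤ P.top, P.cut (P.st N ω t v).table j =
    truncate P.idBound P.distBound P.slots (N.distTable (P.level ω j) v)

include hid hR in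
/-- At the end of a phase the nodes decide unanimously. -/
lemma PhaseStart.phase_end [Fintype V] (hD : ∀ u v, N.dist u v < P.distBound)
    (h : PhaseStart N ω t g) (hlt : ∀ s < t, ∀ v, ¬ (P.st N ω s v).done) :
    (N.spDiam < g → Finished N ω (t + 3 * g + 2)) ∧
    (Finished N ω (t + 3 * g + 2) ∨ (PhaseStart N ω (t + 3 * g + 2) (2 * g) ∧
      ∀ s < t + 3 * g + 2, ∀ v, ¬ (P.st N ω s v).done)) := by
  have hlt' : ∀ s < t + 3 * g + 2, ∀ v, ¬ (P.st N ω s v).done := by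
    intro s hs v
    rcases lt_or_ge s t with h1 | h1
    · exact hlt s h1 v
    obtain ⟨i, rfl⟩ := Nat.exists_eq_add_of_le h1
    rcases le_or_gt i g with h2 | h2
    · exact (h.flood_root hid hR i h2 v).1.2.2
    · obtain ⟨k, rfl⟩ := Nat.exists_eq_add_of_lt h2
      have := (h.flood_bad hid hR k (by omega) v).1.2.2
      rwa [show t + (g + k + 1) = t + g + 1 + k by ring]
  have hend : ∀ v, (P.st N ω (t + 3 * g + 2) v).root = N.ident v ∧
      ¬ (P.st N ω (t + 3 * g + 2) v).bad ∧ (P.st N ω (t + 3 * g + 2) v).guess = 2 * g ∧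
      (P.st N ω (t + 3 * g + 2) v).tick = 0 ∧
      ((P.st N ω (t + 3 * g + 2) v).done ↔ ∀ u, ∀ p : N.graph.Walk v u, p.length ≤ 2 * g →
        ¬ Objects N ω (t + g) u) := by
    intro v
    obtain ⟨⟨h1, h2, h3⟩, h4⟩ := h.flood_bad hid hR (2 * g) le_rfl v
    have hs := st_succ_of_phase_end (P := P) (N := N) ω (t := t + g + 1 + 2 * g) (v := v) (by omega)
    rw [show t + 3 * g + 2 = t + g + 1 + 2 * g + 1 by ring, hs]
    refine ⟨rfl, not_false, by simp [h2], rfl, ?_⟩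
    simp only [h4]
    push Not
    rfl
  have hfin : (∀ u, ¬ Objects N ω (t + g) u) → Finished N ω (t + 3 * g + 2) := by
    intro hno
    refine ⟨hlt', fun v => (hend v).2.2.2.2.2 fun u _ _ => hno u, fun v j hj => ?_⟩
    have hst : Stable N ω (t + g) := fun v j hj => by
      by_contra hne
      exact hno v (.inr ⟨j, hj, hne⟩)
    exact hst.cut_eq hid hD v hj (by omega)
  refine ⟨fun hg => hfin fun u hu => ?_, ?_⟩
  · -- Every node has seen the least identity number of the network, and the tables are exact.
    rcases hu with ⟨w, -, hw⟩ | ⟨j, hj, hne⟩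
    · have key : ∀ x y, (P.st N ω (t + g) x).root ≤ (P.st N ω (t + g) y).root := by
        intro x y
        obtain ⟨-, ⟨z, -, -, hz⟩, -⟩ := h.flood_root hid hR g le_rfl y
        obtain ⟨p, -, hp⟩ := N.exists_shortest_walk x z
        rw [hz]
        exact (h.flood_root hid hR g le_rfl x).2.2 z p (by omega)
      exact hw (le_antisymm (key _ _) (key _ _))
    · exact hne (stable_of_spDiam_lt hid hD (by omega) u j hj)
  · by_cases hex : ∃ v, (P.st N ω (t + 3 * g + 2) v).done
    · obtain ⟨v, hv⟩ := hex
      exact .inl (hfin (h.not_objects hid hR ((hend v).2.2.2.2.1 hv)))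
    · push Not at hex
      refine .inr ⟨fun v => ?_, hlt'⟩
      obtain ⟨h1, h2, h3, h4, -⟩ := hend v
      exact ⟨h1, h2, h3, h4, hex v⟩

include hid hR in
/-- The phases are geometrically growing, and a phase with a guess above the shortest-path
diameter is the last one. -/
lemma exists_finished [Fintype V] (hD : ∀ u v, N.dist u v < P.distBound) (hS : 1 ≤ N.spDiam)
    (ω : V → Fin P.top → Bool) : ∃ t ≤ 20 * N.spDiam, Finished N ω t := by
  have key : ∀ k, (∃ t ≤ 5 * 2 ^ k, Finished N ω t) ∨
      ∃ t, t + 5 ≤ 5 * 2 ^ k ∧ PhaseStart N ω t (2 ^ k) ∧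
        ∀ s < t, ∀ v, ¬ (P.st N ω s v).done := by
    intro k
    induction k with
    | zero => exact .inr ⟨0, by simp, fun v => ⟨rfl, not_false, rfl, rfl, not_false⟩, by simp⟩
    | succ k ih =>
      have hpow : 1 ≤ 2 ^ k := Nat.one_le_two_pow
      -- A phase with the guess `2 ^ k` takes `3 * 2 ^ k + 2` super-rounds, at most `5 * 2 ^ k`.
      rcases ih with ⟨t, ht, hf⟩ | ⟨t, ht, hp, hn⟩
      · exact .inl ⟨t, by rw [pow_succ]; omega, hf⟩
      · rcases (hp.phase_end hid hR hD hn).2 with hf | ⟨hp', hn'⟩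
        · exact .inl ⟨_, by rw [pow_succ]; omega, hf⟩
        · exact .inr ⟨_, by rw [pow_succ]; omega, by rwa [pow_succ, mul_comm (2 ^ k) 2], hn'⟩
  have h1 := Nat.lt_pow_succ_log_self (b := 2) (by norm_num) N.spDiam
  have h2 := Nat.pow_log_le_self 2 (x := N.spDiam) (by omega)
  rcases key (Nat.log 2 N.spDiam + 1) with ⟨t, ht, hf⟩ | ⟨t, ht, hp, hn⟩
  · exact ⟨t, by rw [pow_succ] at ht; omega, hf⟩
  · refine ⟨_, ?_, (hp.phase_end hid hR hD hn).1 h1⟩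
    rw [pow_succ] at ht ⊢
    have hpow : 1 ≤ 2 ^ Nat.log 2 N.spDiam := Nat.one_le_two_pow
    omega

end Params

end DistSketch

/-! ### The stretch of the estimates -/

namespace DistSketch

open Network

/-- The estimate that two nodes with the tables `T` and `T'` agree on: the least length of a detour
over a node that occurs in tables of both nodes for the same level. -/
noncomputable def detour (top : ℕ) (T T' : ℕ → ℕ → ℕ∞) : ℕ∞ :=
  ⨅ j, ⨅ _ : j ≤ top, ⨅ x, T j x + T' j x

lemma detour_comm (top : ℕ) (T T' : ℕ → ℕ → ℕ∞) : detour top T T' = detour top T' T := by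
  simp only [detour, add_comm]

lemma detour_le {top j : ℕ} (hj : j ≤ top) (T T' : ℕ → ℕ → ℕ∞) (x : ℕ) :
    detour top T T' ≤ T j x + T' j x :=
  (iInf₂_le j hj).trans (iInf_le _ x)

lemma detour_congr {top : ℕ} {T₁ T₂ T₁' T₂' : ℕ → ℕ → ℕ∞} (h : ∀ j ≤ top, T₁ j = T₂ j)
    (h' : ∀ j ≤ top, T₁' j = T₂' j) : detour top T₁ T₁' = detour top T₂ T₂' :=
  iInf_congr fun j => iInf_congr fun hj => by rw [h j hj, h' j hj]

variable {V : Type} (N : Network V)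

/-- The truncated distance tables of the node `v` for the levels `A`. -/
noncomputable def levelTable (Q D R : ℕ) (A : ℕ → V → Prop) (v : V) (j : ℕ) : ℕ → ℕ∞ :=
  truncate Q D R (N.distTable (A j) v)

/-- The levels `A` are well spread with respect to neighbourhoods `near i u`, which
consist of nodes that are nearest to `u`: the `j`-th level meets every `j`-th neighbourhood, and
it has less than `R` nodes in every `(j + 1)`-st one. The last neighbourhood is the network. -/
structure WellSpread (R top : ℕ) (A : ℕ → V → Prop) (near : ℕ → V → Finset V) : Prop where
  zero : ∀ v, A 0 v
  nearest : ∀ i u, ∀ x ∈ near i u, ∀ y ∉ near i u, N.dist u x ≤ N.dist u y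
  meets : ∀ j ≤ top, ∀ u, ∃ x ∈ near j u, A j x
  few : ∀ j ≤ top, ∀ u, {x | x ∈ near (j + 1) u ∧ A j x}.ncard < R
  last : ∀ u x, x ∈ near (top + 1) u

variable {N} {Q D R top : ℕ} {A : ℕ → V → Prop} {near : ℕ → V → Finset V}

lemma dist_le_detour (u v : V) :
    (N.dist u v : ℕ∞) ≤ detour top (levelTable N Q D R A u) (levelTable N Q D R A v) := by
  refine le_iInf₂ fun j hj => le_iInf fun x => ?_
  refine le_trans ?_ (add_le_add (le_truncate (h := N.distTable (A j) u))
    (le_truncate (h := N.distTable (A j) v)))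
  by_cases htop : N.distTable (A j) v x = ⊤
  · simp [htop]
  · obtain ⟨w, hw, rfl⟩ := exists_of_distTable_ne_top htop
    rw [distTable_ident hw, distTable_ident hw, N.dist_comm v w]
    exact_mod_cast N.dist_triangle u w v

section

variable (hid : ∀ v, N.ident v < Q) (hD : ∀ u v, N.dist u v < D)
include hid hD

lemma levelTable_of_rank_lt {j : ℕ} {v w : V} (hw : A j w)
    (h : rank Q (N.distTable (A j) v) (N.ident w) < R) :
    levelTable N Q D R A v j (N.ident w) = N.dist v w := by
  rw [levelTable, truncate, if_pos, distTable_ident hw]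
  exact ⟨hid w, by rw [distTable_ident hw]; exact_mod_cast hD v w, h⟩

/-- The nearest node of a level is in the table. -/
lemma exists_levelTable_eq (hR : 0 < R) {j : ℕ} {z : V} (hz : A j z) (v : V) :
    ∃ w, A j w ∧ N.dist v w ≤ N.dist v z ∧ levelTable N Q D R A v j (N.ident w) = N.dist v w := by
  have hQ : 0 < Q := (Nat.zero_le _).trans_lt (hid z)
  obtain ⟨y, hy, hy0⟩ := exists_rank_eq (h := N.distTable (A j) v) hQ
  have hnot : ¬ Before (N.distTable (A j) v) (N.ident z) y := fun hb => by
    have := rank_lt_rank (hid z) hb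
    omega
  have hle : N.distTable (A j) v y ≤ N.dist v z := by
    rw [← distTable_ident hz]
    exact le_of_not_gt fun h => hnot (.inl h)
  obtain ⟨w, hw, rfl⟩ := exists_of_distTable_ne_top (hle.trans_lt (ENat.natCast_lt_top _)).ne
  refine ⟨w, hw, ?_, levelTable_of_rank_lt hid hD hw (by omega)⟩
  rw [distTable_ident hw] at hle
  exact_mod_cast hle

/-- A node of a level that is missing in the table of `v` is at least as far away from `v` as some
node of the next level. -/
lemma WellSpread.levelTable_eq_or [Fintype V] (hA : WellSpread N R top A near) {j : ℕ}
    (hj : j ≤ top) {w : V} (hw : A j w) (v : V) :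
    levelTable N Q D R A v j (N.ident w) = N.dist v w ∨
      j + 1 ≤ top ∧ ∃ z, A (j + 1) z ∧ N.dist v z ≤ N.dist v w := by
  classical
  by_cases hr : rank Q (N.distTable (A j) v) (N.ident w) < R
  · exact .inl (levelTable_of_rank_lt hid hD hw hr)
  right
  set S : Set V := {x | A j x ∧ N.dist v x ≤ N.dist v w}
  have hcard : R ≤ S.ncard := by
    rw [← Set.ncard_image_of_injective S N.ident_injective]
    refine (not_lt.1 hr).trans ?_
    rw [rank, ← Set.ncard_coe_finset]
    refine Set.ncard_le_ncard (fun y hy => ?_) (Set.toFinite _)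
    have hle := (Finset.mem_filter.1 (Finset.mem_coe.1 hy)).2.le
    rw [distTable_ident hw] at hle
    obtain ⟨x, hx, rfl⟩ := exists_of_distTable_ne_top (hle.trans_lt (ENat.natCast_lt_top _)).ne
    rw [distTable_ident hx] at hle
    exact ⟨x, ⟨hx, by exact_mod_cast hle⟩, rfl⟩
  obtain ⟨y, hy, hyn⟩ : ∃ y ∈ S, y ∉ near (j + 1) v := by
    by_contra! hne
    have := Set.ncard_le_ncard (s := S) (t := {x | x ∈ near (j + 1) v ∧ A j x})
      (fun x hx => ⟨hne x hx, hx.1⟩) (Set.toFinite _)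
    have := hA.few j hj v
    omega
  have hj' : j + 1 ≤ top := by
    by_contra hlt
    obtain rfl : j = top := by omega
    exact hyn (hA.last v y)
  obtain ⟨z, hz, hAz⟩ := hA.meets (j + 1) hj' v
  exact ⟨hj', z, hAz, (hA.nearest _ _ z hz y hyn).trans hy.2⟩

/-- The search for a common table entry: starting from an entry of the `j`-th level of
one node, either it is also in the table of the other node, or the other node has an entry of the
next level that is farther away by at most the distance of the two nodes. -/
lemma WellSpread.detour_le_of_entry [Fintype V] (hA : WellSpread N R top A near) (hR : 0 < R)
    (k : ℕ) {j : ℕ} (hj : j + k = top) (u v : V) {w : V} (hw : A j w)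
    (hT : levelTable N Q D R A u j (N.ident w) = N.dist u w) (e : ℕ) (he : N.dist u w ≤ e) :
    detour top (levelTable N Q D R A u) (levelTable N Q D R A v) ≤
      (2 * (e + k * N.dist u v) + N.dist u v : ℕ) := by
  have htri := N.dist_triangle v u w
  rw [N.dist_comm v u] at htri
  induction k generalizing j u v w e with
  | zero =>
    rcases hA.levelTable_eq_or hid hD (by omega) hw v with h | ⟨h, -⟩
    · refine (detour_le (j := j) (by omega) _ _ (N.ident w)).trans ?_
      rw [hT, h]
      exact_mod_cast (by omega : N.dist u w + N.dist v w ≤ 2 * (e + 0 * N.dist u v) + N.dist u v)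
    · omega
  | succ k ih =>
    rcases hA.levelTable_eq_or hid hD (by omega) hw v with h | ⟨-, z, hz, hzw⟩
    · refine (detour_le (j := j) (by omega) _ _ (N.ident w)).trans ?_
      rw [hT, h]
      have : 0 ≤ (k + 1) * N.dist u v := Nat.zero_le _
      exact_mod_cast (by omega :
        N.dist u w + N.dist v w ≤ 2 * (e + (k + 1) * N.dist u v) + N.dist u v)
    · obtain ⟨w', hw', hle, hT'⟩ := exists_levelTable_eq hid hD hR hz v
      have htri' := N.dist_triangle u v w'
      have := ih (j := j + 1) (by omega) v u hw' hT' (e + N.dist u v) (by omega)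
        (by rwa [N.dist_comm v u])
      rw [detour_comm]
      refine this.trans ?_
      rw [N.dist_comm v u]
      exact_mod_cast (by ring_nf; rfl :
        2 * (e + N.dist u v + k * N.dist u v) + N.dist u v ≤
          2 * (e + (k + 1) * N.dist u v) + N.dist u v)

/-- The search may start at the highest level whose neighbourhood of `u` does not contain `v`. -/
lemma WellSpread.detour_le_card [Fintype V] [DecidableEq V] (hA : WellSpread N R top A near)
    (hR : 0 < R) (u v : V) :
    detour top (levelTable N Q D R A u) (levelTable N Q D R A v) ≤
      ((3 + 2 * ((Finset.Icc 1 top).filter fun i => v ∈ near i u).card) * N.dist u v : ℕ) := by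
  set F := (Finset.Icc 1 top).filter fun i => v ∈ near i u
  set E := (Finset.Icc 1 top).filter fun i => v ∉ near i u
  by_cases hne : E.Nonempty
  · obtain ⟨hmem, hout⟩ := Finset.mem_filter.1 (E.max'_mem hne)
    set j := E.max' hne
    have hmem := Finset.mem_Icc.1 hmem
    obtain ⟨x, hx, hAx⟩ := hA.meets j hmem.2 u
    obtain ⟨w, hw, hle, hT⟩ := exists_levelTable_eq hid hD hR hAx u
    have hxv := hA.nearest j u x hx v hout
    have hcard : top - j ≤ F.card := by
      calc top - j = (Finset.Icc (j + 1) top).card := by simp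
        _ ≤ F.card := Finset.card_le_card fun i hi => by
          have hi := Finset.mem_Icc.1 hi
          refine Finset.mem_filter.2 ⟨Finset.mem_Icc.2 ⟨by omega, hi.2⟩, ?_⟩
          by_contra hiv
          have := E.le_max' i (Finset.mem_filter.2 ⟨Finset.mem_Icc.2 ⟨by omega, hi.2⟩, hiv⟩)
          omega
    refine (hA.detour_le_of_entry hid hD hR (top - j) (by omega) u v hw hT (N.dist u v)
      (by omega)).trans ?_
    have := Nat.mul_le_mul_right (N.dist u v) hcard
    have h2 : 2 * (N.dist u v + (top - j) * N.dist u v) + N.dist u v ≤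
      (3 + 2 * F.card) * N.dist u v := by linarith
    exact_mod_cast h2
  · have hcard : top ≤ F.card := by
      calc top = (Finset.Icc 1 top).card := by simp
        _ ≤ F.card := Finset.card_le_card fun i hi => by
          refine Finset.mem_filter.2 ⟨hi, ?_⟩
          by_contra hiv
          exact hne ⟨i, Finset.mem_filter.2 ⟨hi, hiv⟩⟩
    obtain ⟨w, hw, hle, hT⟩ := exists_levelTable_eq hid hD hR (hA.zero u) u
    refine (hA.detour_le_of_entry hid hD hR top (zero_add _) u v hw hT 0
      (by simpa using hle)).trans ?_
    have := Nat.mul_le_mul_right (N.dist u v) hcard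
    have h2 : 2 * (0 + top * N.dist u v) + N.dist u v ≤
      (3 + 2 * F.card) * N.dist u v := by linarith [Nat.zero_le (N.dist u v)]
    exact_mod_cast h2

end

/-- Few pairs have a large stretch, as the sizes of the neighbourhoods grow geometrically. -/
lemma averageStretch_le [Fintype V] [DecidableEq V] (d' : V → V → ℕ) {m : ℕ}
    (hn : 2 ≤ Fintype.card V) (hcard : ∀ i u, (near i u).card ≤ m * 2 ^ i)
    (htop : 0 < top → m * 2 ^ top ≤ Fintype.card V)
    (hd' : ∀ u v, d' u v ≤
      (3 + 2 * ((Finset.Icc 1 top).filter fun i => v ∈ near i u).card) * N.dist u v) :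
    averageStretch N d' ≤ 11 := by
  set n := Fintype.card V with hndef
  set c : V → V → ℕ := fun u v => ((Finset.Icc 1 top).filter fun i => v ∈ near i u).card with hc
  have hpair : ∀ u v, pairStretch N d' u v ≤ 3 + 2 * (c u v : ℝ) := by
    intro u v
    unfold pairStretch
    split_ifs with h0
    · have : (0 : ℝ) ≤ c u v := Nat.cast_nonneg _
      linarith
    · have hpos : (0 : ℝ) < N.dist u v := by exact_mod_cast Nat.pos_of_ne_zero h0
      rw [div_le_iff₀ hpos]
      exact_mod_cast hd' u v
  have hrow : ∀ u, ∑ v, c u v ≤ 2 * n := by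
    intro u
    have hswap : ∑ v, c u v = ∑ i ∈ Finset.Icc 1 top, (near i u).card := by
      simp only [hc, Finset.card_filter]
      rw [Finset.sum_comm]
      refine Finset.sum_congr rfl fun i _ => ?_
      rw [← Finset.card_filter]
      congr 1
      ext v
      simp
    rw [hswap]
    rcases Nat.eq_zero_or_pos top with h0 | h0
    · simp [h0]
    · calc ∑ i ∈ Finset.Icc 1 top, (near i u).card
          ≤ ∑ i ∈ Finset.range (top + 1), m * 2 ^ i := by
            refine (Finset.sum_le_sum fun i _ => hcard i u).trans
              (Finset.sum_le_sum_of_subset fun i hi => ?_)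
            have := Finset.mem_Icc.1 hi
            exact Finset.mem_range.2 (by omega)
        _ ≤ m * (2 * 2 ^ top) := by
            rw [← Finset.mul_sum]
            refine Nat.mul_le_mul_left m ?_
            have := Nat.geomSum_eq (le_refl 2) (top + 1)
            rw [this, pow_succ]
            simp only [Nat.add_one_sub_one, Nat.div_one]
            omega
        _ = 2 * (m * 2 ^ top) := by ring
        _ ≤ 2 * n := Nat.mul_le_mul_left 2 (htop h0)
  have hnR : (2 : ℝ) ≤ n := by exact_mod_cast hn
  have hpos : (0 : ℝ) < (n : ℝ) * ((n : ℝ) - 1) := by nlinarith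
  have htotal : ∑ p ∈ (Finset.univ : Finset V).offDiag, (c p.1 p.2 : ℝ) ≤ n * (2 * n) := by
    calc ∑ p ∈ (Finset.univ : Finset V).offDiag, (c p.1 p.2 : ℝ)
        ≤ ∑ p : V × V, (c p.1 p.2 : ℝ) :=
          Finset.sum_le_sum_of_subset_of_nonneg (Finset.subset_univ _)
            fun _ _ _ => Nat.cast_nonneg _
      _ = ∑ u, ∑ v, (c u v : ℝ) := Fintype.sum_prod_type _
      _ ≤ ∑ _u : V, (2 * n : ℝ) := Finset.sum_le_sum fun u _ => by exact_mod_cast hrow u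
      _ = n * (2 * n) := by simp [hndef]
  rw [averageStretch, div_le_iff₀ hpos]
  calc ∑ p ∈ (Finset.univ : Finset V).offDiag, pairStretch N d' p.1 p.2
      ≤ ∑ p ∈ (Finset.univ : Finset V).offDiag, (3 + 2 * (c p.1 p.2 : ℝ)) :=
        Finset.sum_le_sum fun p _ => hpair p.1 p.2
    _ = 3 * (n * (n - 1)) + 2 * ∑ p ∈ (Finset.univ : Finset V).offDiag, (c p.1 p.2 : ℝ) := by
        rw [Finset.sum_add_distrib, ← Finset.mul_sum, Finset.sum_const, Finset.offDiag_card,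
          Finset.card_univ, nsmul_eq_mul, Nat.cast_sub (Nat.le_mul_self _)]
        push_cast
        ring
    _ ≤ 11 * (n * (n - 1)) := by nlinarith

end DistSketch

/-! ### The levels are well spread with high probability -/

namespace DistSketch

section Counting

variable {ι β : Type} [Fintype ι] [DecidableEq ι] [Fintype β]

lemma sum_prod_eq_prod_sum (f : ι → β → ℝ) :
    ∑ ω : ι → β, ∏ i, f i (ω i) = ∏ i, ∑ b, f i b := by
  rw [Finset.prod_univ_sum, Fintype.piFinset_univ]

/-- The values at the points of `s` of a uniformly random function are independent. -/
lemma sum_prod_div_card (s : Finset ι) (g : β → ℝ) [Nonempty β] :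
    (∑ ω : ι → β, ∏ i ∈ s, g (ω i)) / Nat.card (ι → β) =
      ((∑ b, g b) / Fintype.card β) ^ s.card := by
  classical
  have h1 : ∀ ω : ι → β, ∏ i ∈ s, g (ω i) = ∏ i, if i ∈ s then g (ω i) else 1 := fun ω => by
    rw [Finset.prod_ite_mem, Finset.univ_inter]
  have hβ : (Fintype.card β : ℝ) ≠ 0 := by exact_mod_cast Fintype.card_ne_zero
  have h2 : (Nat.card (ι → β) : ℝ) = ∏ _i : ι, (Fintype.card β : ℝ) := by
    rw [Nat.card_eq_fintype_card, Fintype.card_fun]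
    simp
  simp_rw [h1]
  rw [sum_prod_eq_prod_sum (fun i b => if i ∈ s then g b else 1), h2, ← Finset.prod_div_distrib]
  rw [← Finset.prod_const, ← Finset.univ_inter s, ← Finset.prod_ite_mem]
  refine Finset.prod_congr rfl fun i _ => ?_
  simp only [Finset.univ_inter]
  split_ifs with hi
  · rfl
  · simp [hβ]

/-- Markov's inequality for products over a uniformly random function. -/
lemma ncard_div_card_mul_le (s : Finset ι) (g : β → ℝ) (hg : ∀ b, 0 ≤ g b) [Nonempty β]
    (E : Set (ι → β)) (K : ℝ) (hE : ∀ ω ∈ E, K ≤ ∏ i ∈ s, g (ω i)) :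
    (E.ncard : ℝ) / Nat.card (ι → β) * K ≤ ((∑ b, g b) / Fintype.card β) ^ s.card := by
  classical
  rw [← sum_prod_div_card, div_mul_eq_mul_div]
  refine div_le_div_of_nonneg_right ?_ (Nat.cast_nonneg _)
  rw [Set.ncard_eq_toFinset_card', ← nsmul_eq_mul]
  refine (Finset.card_nsmul_le_sum E.toFinset (fun ω => ∏ i ∈ s, g (ω i)) K fun ω hω =>
    hE ω (Set.mem_toFinset.1 hω)).trans ?_
  exact Finset.sum_le_sum_of_subset_of_nonneg (Finset.subset_univ _) fun ω _ _ =>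
    Finset.prod_nonneg fun i _ => hg _

open Classical in
lemma sum_heads {top j : ℕ} (hj : j ≤ top) :
    (∑ b : Fin top → Bool, if Heads b j then (1 : ℝ) else 0) / Fintype.card (Fin top → Bool) =
      (1 / 2) ^ j := by
  have h1 : ∀ b : Fin top → Bool, (if Heads b j then (1 : ℝ) else 0) =
      ∏ i ∈ (Finset.univ.filter fun i : Fin top => (i : ℕ) < j), if b i then (1 : ℝ) else 0 := by
    intro b
    rw [Finset.prod_ite_zero, Finset.prod_const_one]
    by_cases h : Heads b j
    · rw [if_pos h, if_pos fun i hi => h i (by simpa using hi)]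
    · rw [if_neg h, if_neg fun h' => h fun i hi => h' i (by simp [hi])]
  have hcard : (Finset.univ.filter fun i : Fin top => (i : ℕ) < j).card = j := by
    rw [Fin.card_filter_val_lt, min_eq_right hj]
  simp_rw [h1]
  have := sum_prod_div_card (Finset.univ.filter fun i : Fin top => (i : ℕ) < j)
    (fun b : Bool => if b then (1 : ℝ) else 0)
  rw [Nat.card_eq_fintype_card, hcard] at this
  rw [this]
  simp

open Classical in
lemma sum_heads_ite {top j : ℕ} (hj : j ≤ top) (p q : ℝ) :
    (∑ b : Fin top → Bool, if Heads b j then p else q) / Fintype.card (Fin top → Bool) =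
      q + (p - q) * (1 / 2) ^ j := by
  have h1 : ∀ b : Fin top → Bool, (if Heads b j then p else q) =
      q + (p - q) * if Heads b j then (1 : ℝ) else 0 := fun b => by split_ifs <;> ring
  simp_rw [h1]
  rw [Finset.sum_add_distrib, ← Finset.mul_sum, add_div, mul_div_assoc, sum_heads hj]
  simp

end Counting

section Sampling

variable {V : Type} [Fintype V] {top j : ℕ}

lemma prob_not_meets_le (hj : j ≤ top) (s : Finset V) :
    ({ω : V → Fin top → Bool | ∀ x ∈ s, ¬ Heads (ω x) j}.ncard : ℝ) /
      Nat.card (V → Fin top → Bool) ≤ (1 - (1 / 2) ^ j) ^ s.card := by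
  classical
  have := ncard_div_card_mul_le s (fun b : Fin top → Bool => if Heads b j then (0 : ℝ) else 1)
    (fun b => by split_ifs <;> norm_num) {ω | ∀ x ∈ s, ¬ Heads (ω x) j} 1 (fun ω hω => by
      rw [Finset.prod_congr rfl fun x hx => if_neg (hω x hx)]
      simp)
  rw [sum_heads_ite hj] at this
  rw [mul_one] at this
  refine this.trans_eq ?_
  congr 1
  ring

/-- The bound comes from the expectation of `2 ^ X` for the number `X` of sampled nodes of `s`. -/
lemma prob_many_le (hj : j ≤ top) (s : Finset V) (R : ℕ) :
    ({ω : V → Fin top → Bool | R ≤ {x | x ∈ s ∧ Heads (ω x) j}.ncard}.ncard : ℝ) /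
      Nat.card (V → Fin top → Bool) * 2 ^ R ≤ (1 + (1 / 2) ^ j) ^ s.card := by
  classical
  have := ncard_div_card_mul_le s (fun b : Fin top → Bool => if Heads b j then (2 : ℝ) else 1)
    (fun b => by split_ifs <;> norm_num) {ω | R ≤ {x | x ∈ s ∧ Heads (ω x) j}.ncard} (2 ^ R)
    (fun ω hω => by
      rw [Finset.prod_ite, Finset.prod_const, Finset.prod_const_one, mul_one]
      refine pow_le_pow_right₀ (by norm_num) ?_
      rw [← Set.ncard_coe_finset]
      simpa using hω)
  rw [sum_heads_ite hj] at this
  refine this.trans_eq ?_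
  congr 1
  ring

/-- Neighbourhoods of every size that consist of the elements with the least values of `f`. -/
lemma exists_nearest (f : V → ℕ) : ∃ s : ℕ → Finset V,
    (∀ k, (s k).card = min k (Fintype.card V)) ∧ ∀ k, ∀ x ∈ s k, ∀ y ∉ s k, f x ≤ f y := by
  set e := Fintype.equivFin V
  set σ := (Tuple.sort (f ∘ e.symm)).trans e.symm
  have hmono : Monotone (f ∘ σ) := Tuple.monotone_sort (f ∘ e.symm)
  refine ⟨fun k => (Finset.univ.filter fun i : Fin (Fintype.card V) => (i : ℕ) < k).map
    σ.toEmbedding, fun k => ?_, fun k x hx y hy => ?_⟩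
  · rw [Finset.card_map, Fin.card_filter_val_lt, min_comm]
  · simp only [Finset.mem_map_equiv, Finset.mem_filter, Finset.mem_univ, true_and] at hx hy
    have := hmono (show σ.symm x ≤ σ.symm y from Fin.le_def.2 (by omega))
    simpa using this

end Sampling

/-- The oversampling factor: the `j`-th neighbourhoods have `sampleSize a n * 2 ^ j` nodes. -/
def sampleSize (a n : ℕ) : ℕ := (a + 4) * Nat.clog 2 n

/-- The highest level: the largest `i` with `sampleSize a n * 2 ^ i ≤ n`, and `0` if there is none.
So the `(topLevel a n + 1)`-st neighbourhoods are the whole network. -/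
def topLevel (a n : ℕ) : ℕ := Nat.log 2 (n / sampleSize a n)

section Parameters

variable {a n : ℕ}

lemma sampleSize_pos (hn : 2 ≤ n) : 0 < sampleSize a n :=
  Nat.mul_pos (by omega) (Nat.clog_pos (by norm_num) hn)

lemma sampleSize_mul_pow_le (h : 0 < topLevel a n) : sampleSize a n * 2 ^ topLevel a n ≤ n := by
  have h0 : n / sampleSize a n ≠ 0 := fun h0 => by simp [topLevel, h0] at h
  rw [mul_comm]
  exact (Nat.mul_le_mul_right _ (Nat.pow_log_le_self 2 h0)).trans (Nat.div_mul_le_self _ _)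

lemma lt_sampleSize_mul_pow (hn : 2 ≤ n) : n < sampleSize a n * 2 ^ (topLevel a n + 1) := by
  rw [mul_comm]
  exact (Nat.div_lt_iff_lt_mul (sampleSize_pos hn)).1 (Nat.lt_pow_succ_log_self (by norm_num) _)

lemma topLevel_le : topLevel a n ≤ Nat.log 2 n := Nat.log_mono_right (Nat.div_le_self _ _)

lemma one_half_pow_sampleSize_le (hn : 2 ≤ n) :
    (1 / 2 : ℝ) ^ sampleSize a n ≤ 1 / (n : ℝ) ^ (a + 4) := by
  rw [one_div_pow]
  refine one_div_le_one_div_of_le (by positivity) ?_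
  rw [sampleSize, mul_comm, pow_mul]
  refine pow_le_pow_left₀ (Nat.cast_nonneg _) ?_ _
  exact_mod_cast Nat.le_pow_clog (by norm_num) n

/-- The probability that a sample with rate `2 ^ (-j)` misses a neighbourhood. -/
lemma one_sub_pow_le {j : ℕ} (m : ℕ) : (1 - (1 / 2 : ℝ) ^ j) ^ (m * 2 ^ j) ≤ (1 / 2) ^ m := by
  have h1 : (1 - (1 / 2 : ℝ) ^ j) ≤ Real.exp (-(1 / 2) ^ j) := by
    have := Real.add_one_le_exp (-(1 / 2 : ℝ) ^ j)
    linarith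
  have h0 : 0 ≤ 1 - (1 / 2 : ℝ) ^ j := by
    have : (1 / 2 : ℝ) ^ j ≤ 1 := pow_le_one₀ (by norm_num) (by norm_num)
    linarith
  have h2 : Real.exp (-1) ≤ 1 / 2 := by
    rw [Real.exp_neg, ← one_div]
    refine one_div_le_one_div_of_le (by norm_num) ?_
    have := Real.add_one_le_exp (1 : ℝ)
    linarith
  calc (1 - (1 / 2 : ℝ) ^ j) ^ (m * 2 ^ j) ≤ Real.exp (-(1 / 2) ^ j) ^ (m * 2 ^ j) :=
        pow_le_pow_left₀ h0 h1 _
    _ = Real.exp (-1) ^ m := by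
        rw [← Real.exp_nat_mul, ← Real.exp_nat_mul]
        congr 1
        push_cast
        rw [mul_assoc, mul_neg, ← mul_pow]
        norm_num
    _ ≤ _ := pow_le_pow_left₀ (Real.exp_pos _).le h2 _

/-- The factor `6` in the size `6 * m` of the tables leaves room for the expectation of `2 ^ X`,
where `X` is a number with mean at most `2 * m`. -/
lemma one_add_pow_le {j k m : ℕ} (hk : k ≤ m * 2 ^ (j + 1)) :
    (1 + (1 / 2 : ℝ) ^ j) ^ k ≤ (1 / 2) ^ m * 2 ^ (6 * m) := by
  have h1 : (1 + (1 / 2 : ℝ) ^ j) ≤ Real.exp ((1 / 2) ^ j) := by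
    have := Real.add_one_le_exp ((1 / 2 : ℝ) ^ j)
    linarith
  have h2 : Real.exp 2 ≤ 8 := by
    have h := Real.exp_one_lt_d9
    have : Real.exp 2 = Real.exp 1 * Real.exp 1 := by rw [← Real.exp_add]; norm_num
    rw [this]
    nlinarith [Real.exp_pos 1]
  calc (1 + (1 / 2 : ℝ) ^ j) ^ k ≤ (1 + (1 / 2 : ℝ) ^ j) ^ (m * 2 ^ (j + 1)) :=
        pow_le_pow_right₀ (by simp) hk
    _ ≤ Real.exp ((1 / 2) ^ j) ^ (m * 2 ^ (j + 1)) := pow_le_pow_left₀ (by positivity) h1 _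
    _ = Real.exp 2 ^ m := by
        rw [← Real.exp_nat_mul, ← Real.exp_nat_mul]
        congr 1
        push_cast
        rw [pow_succ, mul_assoc, mul_comm ((2 : ℝ) ^ j) 2, mul_assoc, ← mul_pow]
        norm_num
    _ ≤ 32 ^ m := pow_le_pow_left₀ (Real.exp_pos _).le (h2.trans (by norm_num)) _
    _ = (1 / 2) ^ m * 2 ^ (6 * m) := by rw [pow_mul, ← mul_pow]; norm_num

end Parameters

/-- There are neighbourhoods of the intended sizes for which the random levels are well spread with
high probability. -/
lemma exists_prob_wellSpread {V : Type} [Fintype V] (N : Network V) (a : ℕ)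
    (hn : 2 ≤ Fintype.card V) : ∃ near : ℕ → V → Finset V,
      (∀ i u, (near i u).card ≤ sampleSize a (Fintype.card V) * 2 ^ i) ∧
      1 - 1 / (Fintype.card V : ℝ) ^ a ≤
        ({ω : V → Fin (topLevel a (Fintype.card V)) → Bool |
          WellSpread N (6 * sampleSize a (Fintype.card V)) (topLevel a (Fintype.card V))
            (fun j v => Heads (ω v) j) near}.ncard : ℝ) /
          Nat.card (V → Fin (topLevel a (Fintype.card V)) → Bool) := by
  classical
  set n := Fintype.card V
  set m := sampleSize a n
  set top := topLevel a n
  choose s hcard hnear using fun u => exists_nearest (N.dist u)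
  have hmpos : 0 < m := sampleSize_pos hn
  refine ⟨fun i u => s u (m * 2 ^ i), fun i u => (hcard u _).trans_le (min_le_left _ _), ?_⟩
  set Ω := V → Fin top → Bool
  set good : Set Ω := {ω | WellSpread N (6 * m) top (fun j v => Heads (ω v) j)
    fun i u => s u (m * 2 ^ i)}
  -- The two kinds of failures at the level `j` and the node `u`.
  set E : ℕ → V → Set Ω := fun j u => {ω | ∀ x ∈ s u (m * 2 ^ j), ¬ Heads (ω x) j}
  set F : ℕ → V → Set Ω := fun j u =>
    {ω | 6 * m ≤ {x | x ∈ s u (m * 2 ^ (j + 1)) ∧ Heads (ω x) j}.ncard}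
  have hΩ : (0 : ℝ) < Nat.card Ω := by exact_mod_cast Nat.card_pos
  have hE : ∀ j ≤ top, ∀ u, ((E j u).ncard : ℝ) / Nat.card Ω ≤ (1 / 2) ^ m := by
    intro j hj u
    refine (prob_not_meets_le hj _).trans ?_
    rcases Nat.eq_zero_or_pos j with rfl | hj0
    · -- All nodes belong to the lowest level.
      have : (s u (m * 2 ^ 0)).card ≠ 0 := by
        rw [hcard, pow_zero, mul_one]
        omega
      rw [pow_zero, sub_self, zero_pow this]
      positivity
    · have hle : m * 2 ^ j ≤ n :=
        (Nat.mul_le_mul_left m (Nat.pow_le_pow_right (by norm_num) hj)).trans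
          (sampleSize_mul_pow_le (by omega))
      rw [hcard, min_eq_left hle]
      exact one_sub_pow_le m
  have hF : ∀ j ≤ top, ∀ u, ((F j u).ncard : ℝ) / Nat.card Ω ≤ (1 / 2) ^ m := by
    intro j hj u
    have h1 := prob_many_le hj (s u (m * 2 ^ (j + 1))) (6 * m)
    have h2 := h1.trans (one_add_pow_le ((hcard u _).trans_le (min_le_left _ _)))
    exact le_of_mul_le_mul_right h2 (by positivity)
  have hsub : goodᶜ ⊆ ⋃ p ∈ Finset.range (top + 1) ×ˢ (Finset.univ : Finset V),
      (E p.1 p.2 ∪ F p.1 p.2) := by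
    intro ω hω
    by_contra hno
    simp only [Set.mem_iUnion, not_exists] at hno
    have hno' : ∀ j ≤ top, ∀ u, ω ∉ E j u ∪ F j u := fun j hj u =>
      hno (j, u) (by simp; omega)
    refine hω ⟨fun v i hi => absurd hi (Nat.not_lt_zero _), fun i u => hnear u _,
      fun j hj u => ?_, fun j hj u => ?_, fun u x => ?_⟩
    · by_contra! h
      exact hno' j hj u (.inl h)
    · by_contra! h
      exact hno' j hj u (.inr h)
    · have : s u (m * 2 ^ (top + 1)) = Finset.univ := by
        rw [← Finset.card_eq_iff_eq_univ, hcard, min_eq_right (lt_sampleSize_mul_pow hn).le]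
      simp [this]
  have hbad : ((goodᶜ).ncard : ℝ) / Nat.card Ω ≤ 1 / (n : ℝ) ^ a := by
    have h1 : ((goodᶜ).ncard : ℝ) ≤ ∑ p ∈ Finset.range (top + 1) ×ˢ (Finset.univ : Finset V),
        (((E p.1 p.2).ncard : ℝ) + (F p.1 p.2).ncard) := by
      have h2 := (Set.ncard_le_ncard hsub (Set.toFinite _)).trans
        (Finset.set_ncard_biUnion_le _ _)
      refine (Nat.cast_le.2 h2).trans ?_
      push_cast
      exact Finset.sum_le_sum fun p _ => by exact_mod_cast Set.ncard_union_le _ _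
    have hn0 : (0 : ℝ) < n := by exact_mod_cast (by omega : 0 < n)
    have htopn : (top + 1 : ℝ) ≤ n := by
      have : Nat.log 2 n < n := Nat.log_lt_self 2 (by omega)
      have := topLevel_le (a := a) (n := n)
      exact_mod_cast (by omega : top + 1 ≤ n)
    calc ((goodᶜ).ncard : ℝ) / Nat.card Ω
        ≤ (∑ p ∈ Finset.range (top + 1) ×ˢ (Finset.univ : Finset V),
          (((E p.1 p.2).ncard : ℝ) + (F p.1 p.2).ncard)) / Nat.card Ω := by gcongr
      _ ≤ ∑ p ∈ Finset.range (top + 1) ×ˢ (Finset.univ : Finset V),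
          ((1 / 2 : ℝ) ^ m + (1 / 2) ^ m) := by
          rw [Finset.sum_div]
          refine Finset.sum_le_sum fun p hp => ?_
          have hp1 : p.1 ≤ top := by
            have := Finset.mem_range.1 (Finset.mem_product.1 hp).1
            omega
          rw [add_div]
          exact add_le_add (hE _ hp1 _) (hF _ hp1 _)
      _ = (top + 1) * n * (2 * (1 / 2) ^ m) := by
          rw [Finset.sum_const, Finset.card_product, Finset.card_range, Finset.card_univ,
            nsmul_eq_mul]
          push_cast
          ring
      _ ≤ n * n * (n * (1 / (n : ℝ) ^ (a + 4))) := by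
          have h2 : (2 : ℝ) ≤ n := by exact_mod_cast hn
          have h3 := one_half_pow_sampleSize_le (a := a) hn
          gcongr
      _ ≤ 1 / (n : ℝ) ^ a := by
          have h2 : (1 : ℝ) ≤ n := by exact_mod_cast (by omega : 1 ≤ n)
          rw [← sub_nonneg]
          have : 1 / (n : ℝ) ^ a - n * n * (n * (1 / (n : ℝ) ^ (a + 4))) =
              1 / (n : ℝ) ^ a * (1 - 1 / n) := by
            rw [pow_add]
            field_simp
          rw [this]
          have h4 : 1 / (n : ℝ) ≤ 1 := by rw [div_le_one hn0]; exact h2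
          exact mul_nonneg (by positivity) (by linarith)
  have hsum : (good.ncard : ℝ) + (goodᶜ).ncard = Nat.card Ω := by
    exact_mod_cast Set.ncard_add_ncard_compl good
  have : (good.ncard : ℝ) / Nat.card Ω = 1 - (goodᶜ).ncard / Nat.card Ω := by
    rw [eq_sub_iff_add_eq, ← add_div, hsum, div_self hΩ.ne']
  rw [this]
  linarith

end DistSketch

/-! ### The sketching algorithm -/

namespace DistSketch

/-- An identity number, a distance, another identity number and a flag fit into one word. -/
lemma exists_params {n : ℕ} (hn : 2 ≤ n) (c slots top : ℕ) :
    ∃ P : Params (Word (3 * c + 3) n), P.idBound = n ^ c ∧ P.distBound = n ^ (c + 1) ∧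
      P.slots = slots ∧ P.top = top := by
  classical
  set E := Option (Fin (n ^ c) × Fin (n ^ (c + 1))) × Fin (n ^ c) × Prop
  have hpos : 0 < n ^ c := Nat.pow_pos (by omega)
  have hpos' : 0 < n ^ (c + 1) := Nat.pow_pos (by omega)
  have hword : Nat.card (Word (3 * c + 3) n) = 2 ^ ((3 * c + 3) * Nat.clog 2 n) :=
    (Nat.card_congr (⟨BitVec.toFin, BitVec.ofFin, fun _ => rfl, fun _ => rfl⟩ :
      Word (3 * c + 3) n ≃ Fin (2 ^ ((3 * c + 3) * Nat.clog 2 n)))).trans (Nat.card_fin _)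
  have hcard : Nat.card E ≤ Nat.card (Word (3 * c + 3) n) := by
    have h1 : Nat.card E = (n ^ c * n ^ (c + 1) + 1) * (n ^ c * 2) := by
      simp [E]
    rw [h1, hword, mul_comm (3 * c + 3), pow_mul]
    calc (n ^ c * n ^ (c + 1) + 1) * (n ^ c * 2)
        ≤ (n ^ c * n ^ (c + 1) * n) * (n ^ c * n) := by
          have : 0 < n ^ c * n ^ (c + 1) := Nat.mul_pos hpos hpos'
          gcongr
          nlinarith
      _ = n ^ (3 * c + 3) := by ring
      _ ≤ (2 ^ Nat.clog 2 n) ^ (3 * c + 3) :=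
          Nat.pow_le_pow_left (Nat.le_pow_clog (by norm_num) n) _
  have : Finite (Word (3 * c + 3) n) := Nat.finite_of_card_ne_zero (by rw [hword]; positivity)
  obtain ⟨f, hf⟩ : ∃ f : E → Word (3 * c + 3) n, Function.Injective f := by
    have := Fintype.ofFinite E
    have := Fintype.ofFinite (Word (3 * c + 3) n)
    rw [Nat.card_eq_fintype_card, Nat.card_eq_fintype_card] at hcard
    obtain ⟨f⟩ := Function.Embedding.nonempty_of_card_le hcard
    exact ⟨f, f.injective⟩
  set val : E → Option (ℕ × ℕ) × ℕ × Prop :=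
    fun e => (e.1.map fun p => (p.1.1, p.2.1), e.2.1.1, e.2.2)
  have : Nonempty E := ⟨(none, ⟨0, hpos⟩, True)⟩
  refine ⟨⟨n ^ c, n ^ (c + 1), slots, top,
    fun e => if h : ∃ x, val x = e then f h.choose else f (Classical.arbitrary E),
    fun w => val (Function.invFun f w), fun e he hr => ?_⟩, rfl, rfl, rfl, rfl⟩
  have hex : ∃ x, val x = e := by
    obtain ⟨o, r, b⟩ := e
    cases o with
    | none => exact ⟨(none, ⟨r, hr⟩, b), rfl⟩
    | some p =>
      obtain ⟨h1, h2⟩ := he p rfl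
      exact ⟨(some (⟨p.1, h1⟩, ⟨p.2, h2⟩), ⟨r, hr⟩, b), rfl⟩
  simp only [dif_pos hex]
  rw [Function.leftInverse_invFun hf]
  exact hex.choose_spec

namespace Params

variable {M V : Type} (P : Params M)

/-- The tables that are contained in a sketch. -/
noncomputable def sketchTable (L : List M) : ℕ → ℕ → ℕ∞ := P.readTable fun p => L[p]?

/-- The sketching algorithm: the sketch of a node is the list of the words that it would broadcast
next, and the estimate is the least length of a detour over a common table entry. -/
noncomputable abbrev algorithm : SketchAlgorithm M where
  toNodeProgram := P.program.toNodeProgram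
  estimate L L' := (detour P.top (P.sketchTable L) (P.sketchTable L')).toNat
  estimate_comm L L' := by rw [detour_comm]

variable {P} {N : Network V}

/-- Whatever the coins show, the algorithm halts in time, and estimates are determined by the
exact truncated tables. -/
lemma exists_haltsWith [Fintype V] (hid : ∀ v, N.ident v < P.idBound) (hR : 0 < P.slots)
    (hD : ∀ u v, N.dist u v < P.distBound) (hS : 1 ≤ N.spDiam) (ω : V → Fin P.top → Bool) :
    ∃ T ≤ P.len * (20 * N.spDiam), ∃ L : V → List M,
      P.algorithm.HaltsWith N ω T L ∧ (∀ v, (L v).length = P.len) ∧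
      ∀ u v, P.algorithm.estimate (L u) (L v) =
        (detour P.top (levelTable N P.idBound P.distBound P.slots (P.level ω) u)
          (levelTable N P.idBound P.distBound P.slots (P.level ω) v)).toNat := by
  obtain ⟨t, ht, hfin⟩ := exists_finished hid hR hD hS ω
  refine ⟨P.len * t, Nat.mul_le_mul_left _ ht,
    fun v => (List.range P.len).map (P.share (P.st N ω t v)), fun v => ?_, by simp,
    fun u v => ?_⟩
  · have hrun := P.program.run_toNodeProgram N ω (len_pos hR) t fun s hs v =>
      if_neg (hfin.not_done s hs v)
    have := congrFun hrun v
    exact (congrArg P.algorithm.output this).trans (if_pos (hfin.done v))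
  · have htable : ∀ v, ∀ j ≤ P.top,
        P.sketchTable ((List.range P.len).map (P.share (P.st N ω t v))) j =
          levelTable N P.idBound P.distBound P.slots (P.level ω) v j := by
      intro v j hj
      obtain ⟨w, hw⟩ := exists_root_eq ω hid t v
      rw [sketchTable, readTable_share (x := P.st N ω t v) (hw ▸ hid w)
        (fun p hp => by simp [hp]) hj, hfin.cut_eq v j hj]
      rfl
    exact congrArg ENat.toNat (detour_congr (htable u) (htable v))

end Params

lemma clog_le_log {n : ℕ} (hn : 2 ≤ n) : (Nat.clog 2 n : ℝ) ≤ 3 * Real.log n := by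
  have h1 : 2 ^ (Nat.clog 2 n - 1) ≤ n := (Nat.pow_pred_clog_lt_self (by norm_num) hn).le
  have hpos : 0 < Nat.clog 2 n := Nat.clog_pos (by norm_num) hn
  have hnR : (2 : ℝ) ≤ n := by exact_mod_cast hn
  have h2 : Real.log 2 ≤ Real.log n := Real.log_le_log (by norm_num) hnR
  have h3 : ((Nat.clog 2 n : ℝ) - 1) * Real.log 2 ≤ Real.log n := by
    have h4 : ((2 : ℝ) ^ (Nat.clog 2 n - 1)) ≤ n := by exact_mod_cast h1
    have h5 := Real.log_le_log (by positivity) h4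
    rw [Real.log_pow, Nat.cast_sub hpos] at h5
    simpa using h5
  have := Real.log_two_gt_d9
  nlinarith

lemma topLevel_le_clog {a n : ℕ} : topLevel a n ≤ Nat.clog 2 n :=
  topLevel_le.trans (Nat.log_le_clog 2 n)

lemma sketch_length_le {a n : ℕ} (hn : 2 ≤ n) :
    (((topLevel a n + 1) * (6 * sampleSize a n) : ℕ) : ℝ) ≤ 250 * (a + 4) * Real.log n ^ 4 := by
  have h1 := clog_le_log hn
  have hpos : 1 ≤ Nat.clog 2 n := Nat.clog_pos (by norm_num) hn
  have hnR : (2 : ℝ) ≤ n := by exact_mod_cast hn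
  have h2 : Real.log 2 ≤ Real.log n := Real.log_le_log (by norm_num) hnR
  have h3 := Real.log_two_gt_d9
  have htop := topLevel_le_clog (a := a) (n := n)
  have h4 : (topLevel a n + 1) * (6 * sampleSize a n) ≤
      12 * (a + 4) * (Nat.clog 2 n * Nat.clog 2 n) := by
    calc (topLevel a n + 1) * (6 * sampleSize a n)
        ≤ (2 * Nat.clog 2 n) * (6 * sampleSize a n) := Nat.mul_le_mul_right _ (by omega)
      _ = _ := by rw [sampleSize]; ring
  set x := Real.log n with hx
  have h5 : (Nat.clog 2 n : ℝ) * Nat.clog 2 n ≤ (3 * x) * (3 * x) :=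
    mul_le_mul h1 h1 (Nat.cast_nonneg _) (by linarith)
  have h6 : 12 * (3 * x * (3 * x)) ≤ 250 * x ^ 4 := by
    have : 0.48 ≤ x ^ 2 := by nlinarith
    nlinarith [sq_nonneg x]
  calc (((topLevel a n + 1) * (6 * sampleSize a n) : ℕ) : ℝ)
      ≤ ((12 * (a + 4) * (Nat.clog 2 n * Nat.clog 2 n) : ℕ) : ℝ) := by exact_mod_cast h4
    _ = (a + 4) * (12 * (Nat.clog 2 n * Nat.clog 2 n)) := by push_cast; ring
    _ ≤ (a + 4) * (12 * (3 * x * (3 * x))) := by gcongr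
    _ ≤ (a + 4) * (250 * x ^ 4) := by gcongr
    _ = _ := by ring

/-- The guarantees of the sketching algorithm for suitable parameters. -/
lemma Params.prob_algorithm_ge {M V : Type} [Fintype V] [DecidableEq V] (P : Params M)
    (N : Network V) {n : ℕ} (hcard : Fintype.card V = n) (hn : 2 ≤ n) (a : ℕ)
    (hid : ∀ v, N.ident v < P.idBound) (hdist : ∀ u v, N.dist u v < P.distBound)
    (hR : P.slots = 6 * sampleSize a n) (htop : P.top = topLevel a n) :
    1 - 1 / (n : ℝ) ^ a ≤ P.algorithm.prob V {ω | ∃ (T : ℕ) (L : V → List M),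
      P.algorithm.HaltsWith N ω T L ∧
      (T : ℝ) ≤ 10000 * (a + 4) * N.spDiam * Real.log n ^ 4 ∧
      (P.algorithm.messageCount N ω T : ℝ) ≤
        10000 * (a + 4) * N.spDiam * N.numEdges * Real.log n ^ 4 ∧
      (∀ v, ((L v).length : ℝ) ≤ 10000 * (a + 4) * Real.log n ^ 4) ∧
      (∀ u v, N.dist u v ≤ P.algorithm.estimate (L u) (L v) ∧
        (P.algorithm.estimate (L u) (L v) : ℝ) ≤ 11 * Real.log n * N.dist u v) ∧
      averageStretch N (fun u v => P.algorithm.estimate (L u) (L v)) ≤ 11} := by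
  subst hcard
  have hRpos : 0 < P.slots := by
    rw [hR]
    exact Nat.mul_pos (by norm_num) (sampleSize_pos hn)
  have hlen : (P.len : ℝ) ≤ 250 * (a + 4) * Real.log (Fintype.card V) ^ 4 := by
    rw [Params.len, htop, hR]
    exact sketch_length_le hn
  have hlog : Real.log 2 ≤ Real.log (Fintype.card V) :=
    Real.log_le_log (by norm_num) (by exact_mod_cast hn)
  have hlog2 := Real.log_two_gt_d9
  obtain ⟨near, hsize, hprob⟩ := exists_prob_wellSpread N a hn
  rw [← htop] at hprob
  refine hprob.trans ?_
  refine div_le_div_of_nonneg_right (Nat.cast_le.2 (Set.ncard_le_ncard (fun ω hω => ?_)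
    (Set.toFinite _))) (Nat.cast_nonneg _)
  have hω : WellSpread N P.slots P.top (P.level ω) near := by rw [hR]; exact hω
  obtain ⟨T, hT, L, hhalt, hlength, hest⟩ :=
    Params.exists_haltsWith hid hRpos hdist (N.one_le_spDiam hn) ω
  have hTR : (T : ℝ) ≤ 5000 * (a + 4) * N.spDiam * Real.log (Fintype.card V) ^ 4 := by
    calc (T : ℝ) ≤ (P.len * (20 * N.spDiam) : ℕ) := by exact_mod_cast hT
      _ = P.len * (20 * N.spDiam) := by push_cast; ring
      _ ≤ (250 * (a + 4) * Real.log (Fintype.card V) ^ 4) * (20 * N.spDiam) := by gcongr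
      _ = _ := by ring
  have hupper : ∀ u v, P.algorithm.estimate (L u) (L v) ≤
      (3 + 2 * ((Finset.Icc 1 P.top).filter fun i => v ∈ near i u).card) * N.dist u v := by
    intro u v
    rw [hest]
    exact (ENat.toNat_le_toNat (hω.detour_le_card hid hdist hRpos u v)
      (ENat.natCast_ne_top _)).trans_eq (ENat.toNat_natCast _)
  have hnonneg : (0 : ℝ) ≤ 5000 * (a + 4) * N.spDiam * Real.log (Fintype.card V) ^ 4 := by
    positivity
  refine ⟨T, L, hhalt, ?_, ?_, fun v => ?_, fun u v => ⟨?_, ?_⟩, ?_⟩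
  · linarith
  · have hmsg : (P.algorithm.messageCount N ω T : ℝ) ≤ T * (2 * N.numEdges) := by
      exact_mod_cast P.algorithm.messageCount_le N ω T
    calc (P.algorithm.messageCount N ω T : ℝ) ≤ T * (2 * N.numEdges) := hmsg
      _ ≤ (5000 * (a + 4) * N.spDiam * Real.log (Fintype.card V) ^ 4) * (2 * N.numEdges) := by
        gcongr
      _ = _ := by ring
  · rw [hlength]
    have : (0 : ℝ) ≤ (a + 4) * Real.log (Fintype.card V) ^ 4 := by positivity
    linarith
  · rw [hest]
    have hfin := (hω.detour_le_card hid hdist hRpos u v).trans_lt (ENat.natCast_lt_top _)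
    have := ENat.toNat_le_toNat (dist_le_detour u v) hfin.ne
    simpa using this
  · have h1 : ((Finset.Icc 1 P.top).filter fun i => v ∈ near i u).card ≤
        Nat.clog 2 (Fintype.card V) :=
      (Finset.card_filter_le _ _).trans (by simpa [htop] using topLevel_le_clog)
    have h2 : (P.algorithm.estimate (L u) (L v) : ℝ) ≤
        (3 + 2 * Nat.clog 2 (Fintype.card V)) * N.dist u v := by
      exact_mod_cast (hupper u v).trans (Nat.mul_le_mul_right _ (by omega))
    refine h2.trans (mul_le_mul_of_nonneg_right ?_ (Nat.cast_nonneg _))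
    have := clog_le_log hn
    linarith
  · refine averageStretch_le _ hn hsize ?_ hupper
    rw [htop]
    exact sampleSize_mul_pow_le

end DistSketch

theorem mainTheorem3 :
    ∃ (K : ℝ) (B : ℕ → ℕ) (C : ℕ → ℝ), ∀ a c : ℕ,
      ∃ A : (n : ℕ) → DistSketch.SketchAlgorithm (DistSketch.Word (B c) n),
        ∀ (V : Type) [Fintype V] [DecidableEq V] (N : DistSketch.Network V) (n : ℕ),
          Fintype.card V = n → 2 ≤ n → N.PolyBounded c →
            1 - 1 / (n : ℝ) ^ a ≤
              (A n).prob V {ω | ∃ (T : ℕ) (L : V → List (DistSketch.Word (B c) n)),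
                (A n).HaltsWith N ω T L ∧
                (T : ℝ) ≤ C a * N.spDiam * Real.log n ^ 4 ∧
                ((A n).messageCount N ω T : ℝ) ≤
                  C a * N.spDiam * N.numEdges * Real.log n ^ 4 ∧
                (∀ v, ((L v).length : ℝ) ≤ C a * Real.log n ^ 4) ∧
                (∀ u v, N.dist u v ≤ (A n).estimate (L u) (L v) ∧
                  ((A n).estimate (L u) (L v) : ℝ) ≤ K * Real.log n * N.dist u v) ∧
                DistSketch.averageStretch N (fun u v => (A n).estimate (L u) (L v)) ≤ K} := by
  refine ⟨11, fun c => 3 * c + 3, fun a => 10000 * (a + 4), fun a c => ?_⟩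
  have hparams : ∀ n, ∃ P : DistSketch.Params (DistSketch.Word (3 * c + 3) n), 2 ≤ n →
      P.idBound = n ^ c ∧ P.distBound = n ^ (c + 1) ∧ P.slots = 6 * DistSketch.sampleSize a n ∧
        P.top = DistSketch.topLevel a n := by
    intro n
    by_cases hn : 2 ≤ n
    · obtain ⟨P, hP⟩ := DistSketch.exists_params hn c (6 * DistSketch.sampleSize a n)
        (DistSketch.topLevel a n)
      exact ⟨P, fun _ => hP⟩
    · -- The claim is void; with the bound `0` on identity numbers, no entry has to be encoded.
      exact ⟨⟨0, 0, 0, 0, fun _ => 0, fun _ => (none, 0, True), fun _ _ h => absurd h (by simp)⟩,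
        fun h => absurd h hn⟩
  choose P hP using hparams
  refine ⟨fun n => (P n).algorithm, ?_⟩
  rintro V _ _ N n hcard hn hpoly
  obtain ⟨hQ, hD, hR, htop⟩ := hP n hn
  exact (P n).prob_algorithm_ge N hcard hn a (fun v => hQ ▸ hcard ▸ hpoly.1 v)
    (fun u v => hD ▸ hcard ▸ N.dist_lt hpoly u v) hR htop
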